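/- **PEPS and parent Hamiltonians.** Let $G=(V,E)$ be a finite connected simple graph with physical dimensions $d_v$ ($v\in V$) and bond dimensions $D_e\ge 1$ ($e\in E$). A PEPS on $G$ is given by tensors $A^{(v)}$, each with one physical index $s_v\in\{1,\dots,d_v\}$ and one virtual index $\sigma_e\in\{1,\dots,D_e\}$ for every edge $e$ incident to $v$; its state is $$|\Psi(A)\rangle=\sum_{s}\sum_{\sigma}\prod_{v\in V}A^{(v)}_{s_v,(\sigma_e)_{e\ni v}}\,|s\rangle\in\mathcal H=\bigotimes_{v}\mathbb C^{d_v}.$$ For a region $R\subseteq V$, $\Gamma_R$ maps a tensor $C$ on the virtual indices of the boundary edges of $R$ (exactly one end in $R$) to the vector on $R$ obtained by contracting the tensors $A^{(v)}$, $v\in R$, along the edges inside $R$, and with $C$ along the boundary edges. $R$ is an injective region if $\Gamma_R$ is injective. The PEPS is injective if $V$ has a partition into at least two injective regions (blocks); two blocks are adjacent if an edge of $G$ joins them. Given regions $(R_i)_{i\in\mathcal S}$ ($\mathcal S$ finite), the parent Hamiltonian is $\hat H=\sum_{i\in\mathcal S}\hat H_i$, where $\hat H_i$ acts on $R_i$ as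 the orthogonal projector whose kernel is the support of $\rho_{R_i}=\mathrm{Tr}_{V\setminus R_i}|\Psi(A)\rangle\langle\Psi(A)|$. The interaction range is called sufficiently large if any two adjacent blocks are contained together in some $R_i$. **Interaction graph.** Its vertices are the $i\in\mathcal S$, with $i,j$ adjacent iff $[\hat H_i,\hat H_j]\neq 0$; $d(i,j)$ is its graph distance, $L=\max_{i,j}d(i,j)$ is the linear size, and $D(\hat O,\hat O')=\min\{d(i,j): [\hat O,\hat H_i]\ne0,\ [\hat O',\hat H_j]\neq 0\}$, with $\min\emptyset=\infty$. The gap of $\hat H$ is its smallest nonzero eigenvalue. **Statement.** Consider a sequence, indexed by $n\in\mathbb N$, of injective PEPS on finite connected graphs, with parent Hamiltonians $\hat H^{(n)}$ of sufficiently large interaction range. Assume that the interaction graphs are connected, that their maximum degrees are bounded uniformly in $n$, and that their linear sizes satisfy $L_n\to\infty$. Then for every $n$ the vector $\Psi_n=\Psi(A)$ is nonzero and spans $\ker\hat H^{(n)}$, so that $\hat\Psi_n=\Psi_n/\|\Psi_n\|$ is the unique ground state. Suppose that the ground state has algebraic correlations: there are constants $\alpha\ge0$, $A,B>0$, $k\in\mathbb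 N$ and operators $\hat O_n,\hat O_n'$, each supported on at most $k$ vertices, such that for all large $n$, $D(\hat O_n,\hat O_n')\ge A L_n$ and $$\frac{\bigl|\langle\hat\Psi_n|\hat O_n\hat O_n'|\hat\Psi_n\rangle-\langle\hat\Psi_n|\hat O_n|\hat\Psi_n\rangle\langle\hat\Psi_n|\hat O_n'|\hat\Psi_n\rangle\bigr|}{\|\hat O_n^\dagger\hat\Psi_n\|\,\|\hat O_n'\hat\Psi_n\|}\ \ge\ B L_n^{-\alpha}.$$ Then there is a constant $C$ with $\mathrm{gap}(\hat H^{(n)})\le C(\ln L_n)^2/L_n^2$ for all large $n$. Consequently the dynamical exponent is at least two: if $\mathrm{gap}(\hat H^{(n)})\sim L_n^{-z}$ in the sense that $-\ln\mathrm{gap}(\hat H^{(n)})/\ln L_n\to z$ (so logarithmic corrections are neglected), then $z\ge2$. -/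

import Mathlib

open scoped Matrix InnerProductSpace
open Filter Topology

noncomputable section

/-! ### Local systems, operators acting on a region -/

/-- Configurations (the product basis `|s⟩`) of a system with local dimensions `d`. -/
abbrev Conf {V : Type*} (d : V → ℕ) : Type _ := ∀ v, Fin (d v)

/-- Configurations of the sites in the region `R`. -/
abbrev RegionConf {V : Type*} (d : V → ℕ) (R : Finset V) : Type _ := ∀ v : {v // v ∈ R}, Fin (d v)

/-- Configurations of the sites outside the region `R`. -/
abbrev OutsideConf {V : Type*} (d : V → ℕ) (R : Finset V) : Type _ :=
  ∀ v : {v // v ∉ R}, Fin (d v)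

/-- The Hilbert space `⨂ᵥ ℂ^(d v)`, in its product basis. -/
abbrev StateSpace {V : Type*} (d : V → ℕ) : Type _ := EuclideanSpace ℂ (Conf d)

/-- Glue a configuration inside `R` to one outside `R`. -/
def glue {V : Type*} [DecidableEq V] {d : V → ℕ} {R : Finset V}
    (a : RegionConf d R) (c : OutsideConf d R) : Conf d :=
  fun v => if h : v ∈ R then a ⟨v, h⟩ else c ⟨v, h⟩

/-- The operator `M ⊗ 1` on the whole system, for an operator `M` on the region `R`. -/
def extendOp {V : Type*} [Fintype V] [DecidableEq V] {d : V → ℕ} (R : Finset V)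
    (M : Matrix (RegionConf d R) (RegionConf d R) ℂ) : Matrix (Conf d) (Conf d) ℂ :=
  fun s t => if ∀ v, v ∉ R → s v = t v then M (fun v => s v) (fun v => t v) else 0

/-- The operator `O` acts only on the region `R`. -/
def IsSupportedOn {V : Type*} [Fintype V] [DecidableEq V] {d : V → ℕ}
    (O : Matrix (Conf d) (Conf d) ℂ) (R : Finset V) : Prop :=
  ∃ M, O = extendOp R M

/-- A matrix as an operator on the Hilbert space. -/
abbrev toOp {ι : Type*} [Fintype ι] [DecidableEq ι] (M : Matrix ι ι ℂ) :
    EuclideanSpace ℂ ι →L[ℂ] EuclideanSpace ℂ ι :=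
  Matrix.toEuclideanCLM (n := ι) (𝕜 := ℂ) M

/-- The reduced density matrix `Tr_{V ∖ R} |ψ⟩⟨ψ|`. -/
def reducedDensity {V : Type*} [Fintype V] [DecidableEq V] {d : V → ℕ}
    (ψ : StateSpace d) (R : Finset V) : Matrix (RegionConf d R) (RegionConf d R) ℂ :=
  fun a b => ∑ c : OutsideConf d R, ψ (glue a c) * star (ψ (glue b c))

/-- The support of an operator: the orthogonal complement of its kernel. -/
def opSupport {ι : Type*} [Fintype ι] [DecidableEq ι] (M : Matrix ι ι ℂ) :
    Submodule ℂ (EuclideanSpace ℂ ι) :=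
  (LinearMap.ker (toOp M).toLinearMap)ᗮ

/-- The orthogonal projector on the region `R` whose kernel is the support of the reduced density
matrix of `ψ`. -/
def localProjector {V : Type*} [Fintype V] [DecidableEq V] {d : V → ℕ}
    (ψ : StateSpace d) (R : Finset V) : Matrix (RegionConf d R) (RegionConf d R) ℂ :=
  (Matrix.toEuclideanCLM (n := RegionConf d R) (𝕜 := ℂ)).symm
    (opSupport (reducedDensity ψ R))ᗮ.starProjection

/-- The local terms of the parent Hamiltonian of `ψ` with interaction ranges `R i`. -/
def parentTerm {V S : Type*} [Fintype V] [DecidableEq V] {d : V → ℕ}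
    (ψ : StateSpace d) (R : S → Finset V) (i : S) : Matrix (Conf d) (Conf d) ℂ :=
  extendOp (R i) (localProjector ψ (R i))

/-! ### Sums of local terms: gap, interaction graph, distances -/

/-- The Hamiltonian `∑ i, H i`. -/
def hamiltonian {ι S : Type*} [Fintype S] (H : S → Matrix ι ι ℂ) : Matrix ι ι ℂ := ∑ i, H i

/-- The smallest nonzero eigenvalue. -/
def spectralGap {ι : Type*} [Fintype ι] [DecidableEq ι] (M : Matrix ι ι ℂ) : ℝ :=
  sInf {lam : ℝ | lam ≠ 0 ∧ Module.End.HasEigenvalue (Matrix.toLin' M) (lam : ℂ)}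

/-- The interaction graph: `i` and `j` are adjacent when `[H i, H j] ≠ 0`. -/
def interactionGraph {ι S : Type*} [Fintype ι] (H : S → Matrix ι ι ℂ) : SimpleGraph S where
  Adj i j := ¬ Commute (H i) (H j)
  symm := ⟨fun _ _ h h' => h h'.symm⟩
  loopless := ⟨fun _ h => h (Commute.refl _)⟩

/-- The distance of two operators: the least interaction-graph distance of two local terms of which
the first does not commute with `O` and the second does not commute with `O'`
(`⊤` if there are none). -/
def opDist {ι S : Type*} [Fintype ι] (H : S → Matrix ι ι ℂ) (O O' : Matrix ι ι ℂ) : ℕ∞ :=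
  ⨅ (i : S) (j : S) (_ : ¬ Commute O (H i)) (_ : ¬ Commute O' (H j)),
    (interactionGraph H).edist i j

/-- The linear size: the diameter of the interaction graph. -/
def linearSize {ι S : Type*} [Fintype ι] (H : S → Matrix ι ι ℂ) : ℕ := (interactionGraph H).diam

/-- The normalised connected correlation function of `O` and `O'` in the unit vector `ψ / ‖ψ‖`. -/
def connectedCorrelation {ι : Type*} [Fintype ι] [DecidableEq ι] (ψ : EuclideanSpace ℂ ι)
    (O O' : Matrix ι ι ℂ) : ℝ :=
  let φ : EuclideanSpace ℂ ι := ((‖ψ‖⁻¹ : ℝ) : ℂ) • ψ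
  ‖⟪φ, toOp (O * O') φ⟫_ℂ - ⟪φ, toOp O φ⟫_ℂ * ⟪φ, toOp O' φ⟫_ℂ‖ /
    (‖toOp Oᴴ φ‖ * ‖toOp O' φ‖)

/-- `gap ∼ L ^ (-z)`, up to corrections that are subleading on the logarithmic scale
(in particular up to powers of `log L`). -/
def HasDynamicalExponent (gap L : ℕ → ℝ) (z : ℝ) : Prop :=
  Tendsto (fun n => -Real.log (gap n) / Real.log (L n)) atTop (𝓝 z)

/-! ### Projected entangled pair states -/

/-- The data of a PEPS on the graph `G`: physical dimensions at the vertices, nonzero bond dimensions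
at the edges, and at each vertex a tensor with one physical index and one virtual index for
every incident edge. -/
structure PEPS {V : Type*} (G : SimpleGraph V) where
  physDim : V → ℕ
  bondDim : G.edgeSet → ℕ
  bondDim_pos : ∀ e, 0 < bondDim e
  tensor : ∀ v, Fin (physDim v) → (∀ e : {e : G.edgeSet // v ∈ e.1}, Fin (bondDim e.1)) → ℂ

namespace PEPS

variable {V : Type*} [Fintype V] [DecidableEq V] {G : SimpleGraph V} [DecidableRel G.Adj]

/-- The state `|Ψ(A)⟩` (not normalised). -/
def state (Λ : PEPS G) : StateSpace Λ.physDim :=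
  WithLp.toLp 2 fun s => ∑ σ : (∀ e : G.edgeSet, Fin (Λ.bondDim e)),
    ∏ v, Λ.tensor v (s v) (fun e => σ e.1)

/-- The edges with at least one end in `R`. -/
abbrev TouchingEdge (G : SimpleGraph V) (R : Finset V) : Type _ :=
  {e : G.edgeSet // ∃ v ∈ R, v ∈ e.1}

/-- The edges with exactly one end in `R`. -/
abbrev BoundaryEdge (G : SimpleGraph V) (R : Finset V) : Type _ :=
  {e : TouchingEdge G R // ∃ v, v ∉ R ∧ v ∈ e.1.1}

/-- The map `Γ_R` from boundary tensors to states on `R`: the tensors in `R` are contracted along the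
inner edges of `R`, and with `C` along the boundary edges. -/
def regionMap (Λ : PEPS G) (R : Finset V)
    (C : (∀ e : BoundaryEdge G R, Fin (Λ.bondDim e.1.1)) → ℂ) :
    RegionConf Λ.physDim R → ℂ :=
  fun s => ∑ σ : (∀ e : TouchingEdge G R, Fin (Λ.bondDim e.1)),
    C (fun e => σ e.1) *
      ∏ v : {v // v ∈ R}, Λ.tensor v (s v) (fun e => σ ⟨e.1, v, v.2, e.2⟩)

/-- The region `R` is injective. -/
def InjectiveRegion (Λ : PEPS G) (R : Finset V) : Prop := Function.Injective (Λ.regionMap R)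

/-- A proper covering by disjoint injective regions: a partition of the vertex set into
at least two blocks, each of which is an injective region. These blocks are the
vertices of the super-lattice. A PEPS is injective if it has such a covering. -/
def IsInjectiveCovering (Λ : PEPS G) (P : Finpartition (Finset.univ : Finset V)) : Prop :=
  2 ≤ P.parts.card ∧ ∀ B ∈ P.parts, Λ.InjectiveRegion B

/-- Adjacency in the super-lattice: an edge of `G` joins the two blocks. -/
def BlockAdj (G : SimpleGraph V) (B B' : Finset V) : Prop :=
  B ≠ B' ∧ ∃ v ∈ B, ∃ w ∈ B', G.Adj v w

/-- The interaction ranges are large enough for the super-lattice `P`: any two adjacent blocks lie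
together in one of them. -/
def RangesCover (G : SimpleGraph V) {S : Type*} (R : S → Finset V)
    (P : Finpartition (Finset.univ : Finset V)) : Prop :=
  ∀ B ∈ P.parts, ∀ B' ∈ P.parts, BlockAdj G B B' → ∃ i, B ⊆ R i ∧ B' ⊆ R i

/-- The local terms of the parent Hamiltonian of a PEPS. -/
abbrev term (Λ : PEPS G) {S : Type*} (R : S → Finset V) :
    S → Matrix (Conf Λ.physDim) (Conf Λ.physDim) ℂ :=
  parentTerm Λ.state R

end PEPS

end

/-!
The gap. Order the local terms by a proper colouring of the interaction graph and let `D` be the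
product of the complementary projections `1 - H i`. It fixes the ground state `ψ`, and by the
detectability lemma a spectral gap `γ` forces `‖D x‖² ≤ ‖x‖² / (1 + γ / (g + 1)²)` for `x ⟂ ψ`.
Hence a Chebyshev polynomial of degree `m` in `D* D`, normalised at `1`, is `1 / cosh (2 m η)`-close
to the projection onto `ψ`, where `(g + 1) sinh η ≈ √γ`. On the other hand each factor `D* D`
enlarges the light cone of an operator by a bounded number of steps, so for `m` proportional to the
distance of `O` and `O'` this polynomial does not change the correlator `⟪O* ψ, O' ψ⟫`. Connected
correlations are therefore at most of order `exp (-c L √γ)`, and if they are at least of order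
`L ^ (-α)`, then `√γ` is at most of order `log L / L`.

Uniqueness of the ground state. Inverting `Γ_B` on every block `B` reads out the indices on all
boundary edges of the blocks. A vector in the kernel is a contraction over the two blocks at each
edge, which forces the two readings of an edge to agree and the result not to depend on their
common value; so the vector is a multiple of `Ψ`.
-/

section Ring

variable {A S : Type*} [Ring A]

/-- The ordered product `∏ i ∈ l, (1 - h i)` of the complementary projections along a list. -/
def projProd (h : S → A) (l : List S) : A := (l.map fun i => 1 - h i).prod

@[simp]
theorem projProd_nil (h : S → A) : projProd h [] = 1 := rfl

@[simp]
theorem projProd_cons (h : S → A) (i : S) (l : List S) :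
    projProd h (i :: l) = (1 - h i) * projProd h l := by
  simp [projProd]

theorem projProd_append (h : S → A) (l l' : List S) :
    projProd h (l ++ l') = projProd h l * projProd h l' := by
  simp [projProd]

theorem commute_projProd {h : S → A} {a : A} {l : List S} (ha : ∀ i ∈ l, Commute a (h i)) :
    Commute a (projProd h l) :=
  Commute.list_prod_right _ _ fun b hb => by
    obtain ⟨i, hi, rfl⟩ := List.mem_map.1 hb
    exact (Commute.one_right a).sub_right (ha i hi)

theorem star_projProd [StarRing A] {h : S → A} (hh : ∀ i, IsStarProjection (h i)) (l : List S) :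
    star (projProd h l) = projProd h l.reverse := by
  induction l with
  | nil => simp
  | cons i l ih =>
    rw [projProd_cons, star_mul, ih, List.reverse_cons, projProd_append, projProd_cons,
      projProd_nil, mul_one, (hh i).one_sub.isSelfAdjoint.star_eq]

end Ring

section Projections

variable {𝕜 E S : Type*} [RCLike 𝕜] [NormedAddCommGroup E] [InnerProductSpace 𝕜 E]

variable {h : S → E →L[𝕜] E}

theorem projProd_apply_eq_self {ψ : E} {l : List S} (hψ : ∀ i ∈ l, h i ψ = 0) :
    projProd h l ψ = ψ := by
  induction l with
  | nil => simp
  | cons i l ih => simp_all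

variable (h) in
open Classical in
/-- The norm `‖h j (projProd h l' x)‖` of the component that the factor `1 - h j` of
`projProd h l x` removes, where `l'` is the part of `l` after `j`. It is `0` for `j ∉ l`. -/
noncomputable def projLoss (x : E) : List S → S → ℝ
  | [] => 0
  | i :: l => Function.update (projLoss x l) i ‖h i (projProd h l x)‖

theorem projLoss_of_notMem (x : E) {l : List S} {j : S} (hj : j ∉ l) : projLoss h x l j = 0 := by
  classical
  induction l with
  | nil => rfl
  | cons i l ih =>
    rw [List.mem_cons, not_or] at hj
    rw [projLoss, Function.update_of_ne hj.1, ih hj.2]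

theorem projLoss_nonneg (x : E) (l : List S) (j : S) : 0 ≤ projLoss h x l j := by
  classical
  induction l with
  | nil => rfl
  | cons i l ih =>
    rw [projLoss, Function.update_apply]
    split_ifs
    exacts [norm_nonneg _, ih]

variable [CompleteSpace E]

theorem inner_self_apply_of_isStarProjection {p : E →L[𝕜] E} (hp : IsStarProjection p) (x : E) :
    ⟪x, p x⟫_𝕜 = ((‖p x‖ ^ 2 : ℝ) : 𝕜) := by
  obtain ⟨K, _, rfl⟩ := isStarProjection_iff_eq_starProjection.1 hp
  rw [← Submodule.starProjection_eq_self_iff.2 (K.starProjection_apply_mem x),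
    ← Submodule.inner_starProjection_left_eq_right,
    Submodule.starProjection_eq_self_iff.2 (K.starProjection_apply_mem x),
    inner_self_eq_norm_sq_to_K, RCLike.ofReal_pow]

theorem norm_sq_eq_add_of_isStarProjection {p : E →L[𝕜] E} (hp : IsStarProjection p) (x : E) :
    ‖x‖ ^ 2 = ‖p x‖ ^ 2 + ‖(1 - p) x‖ ^ 2 := by
  obtain ⟨K, _, rfl⟩ := isStarProjection_iff_eq_starProjection.1 hp
  simpa [Submodule.starProjection_orthogonal_val] using
    K.norm_sq_eq_add_norm_sq_starProjection x

theorem norm_apply_le_of_isStarProjection {p : E →L[𝕜] E} (hp : IsStarProjection p) (x : E) :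
    ‖p x‖ ≤ ‖x‖ := by
  simpa using p.le_of_opNorm_le hp.norm_le x

theorem inner_projProd_apply (hh : ∀ i, IsStarProjection (h i)) {χ : E} {l : List S}
    (hχ : ∀ i ∈ l, h i χ = 0) (y : E) : ⟪χ, projProd h l y⟫_𝕜 = ⟪χ, y⟫_𝕜 := by
  rw [← ContinuousLinearMap.adjoint_inner_left, ← ContinuousLinearMap.star_eq_adjoint,
    star_projProd hh, projProd_apply_eq_self fun i hi => hχ i (List.mem_reverse.1 hi)]

theorem sum_projLoss_sq_le [Fintype S] (hh : ∀ i, IsStarProjection (h i)) (x : E) (l : List S) :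
    ∑ j, projLoss h x l j ^ 2 ≤ ‖x‖ ^ 2 - ‖projProd h l x‖ ^ 2 := by
  classical
  induction l with
  | nil => simp [projLoss]
  | cons i l ih =>
    set y := projProd h l x with hy
    have hloss : ∀ j, projLoss h x (i :: l) j ^ 2 ≤
        projLoss h x l j ^ 2 + if j = i then ‖h i y‖ ^ 2 else 0 := fun j => by
      rw [projLoss, Function.update_apply]
      split_ifs
      · exact le_add_of_nonneg_left (sq_nonneg _)
      · exact (add_zero _).ge
    calc ∑ j, projLoss h x (i :: l) j ^ 2
        ≤ ∑ j, projLoss h x l j ^ 2 + ‖h i y‖ ^ 2 := by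
          refine (Finset.sum_le_sum fun j _ => hloss j).trans_eq ?_
          rw [Finset.sum_add_distrib, Finset.sum_ite_eq' Finset.univ i, if_pos (Finset.mem_univ i)]
      _ ≤ (‖x‖ ^ 2 - ‖y‖ ^ 2) + ‖h i y‖ ^ 2 := by gcongr
      _ = ‖x‖ ^ 2 - ‖projProd h (i :: l) x‖ ^ 2 := by
          rw [norm_sq_eq_add_of_isStarProjection (hh i) y, projProd_cons, mul_apply_eq_comp, ← hy]
          ring

/-- Moving `h i` to its own factor `1 - h i`, which it annihilates, costs the losses of the factors
that do not commute with it. -/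
theorem norm_apply_projProd_le (hh : ∀ i, IsStarProjection (h i)) (x : E) {l : List S}
    (hl : l.Nodup) {i : S} (hi : i ∈ l) {s : Finset S} (hs : ∀ j, ¬ Commute (h i) (h j) → j ∈ s) :
    ‖h i (projProd h l x)‖ ≤ ∑ j ∈ s, projLoss h x l j := by
  classical
  induction l with
  | nil => simp at hi
  | cons k l ih =>
    obtain ⟨hkl, hl⟩ := List.nodup_cons.1 hl
    set y := projProd h l x with hy
    rw [projProd_cons, mul_apply_eq_comp, ← hy]
    rcases eq_or_ne i k with rfl | hik
    · rw [← mul_apply_eq_comp, (hh i).mul_one_sub_self, zero_apply, norm_zero]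
      exact Finset.sum_nonneg fun j _ => projLoss_nonneg x _ j
    specialize ih hl (List.mem_of_ne_of_mem hik hi)
    have hmono : ∑ j ∈ s, projLoss h x l j ≤ ∑ j ∈ s, projLoss h x (k :: l) j :=
      Finset.sum_le_sum fun j _ => by
        rcases eq_or_ne j k with rfl | hjk
        · exact (projLoss_of_notMem x hkl).trans_le (projLoss_nonneg x _ j)
        · rw [projLoss, Function.update_of_ne hjk]
    by_cases hc : Commute (h i) (h k)
    · have hswap : h i ((1 - h k) y) = (1 - h k) (h i y) := by
        rw [← mul_apply_eq_comp, ((Commute.one_right _).sub_right hc).eq, mul_apply_eq_comp]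
      rw [hswap]
      exact (norm_apply_le_of_isStarProjection (hh k).one_sub _).trans (ih.trans hmono)
    · have hks : k ∈ s := hs k hc
      calc ‖h i ((1 - h k) y)‖ = ‖h i y - h i (h k y)‖ := by simp
        _ ≤ ‖h i y‖ + ‖h k y‖ :=
          (norm_sub_le _ _).trans (by gcongr; exact norm_apply_le_of_isStarProjection (hh i) _)
        _ ≤ ∑ j ∈ s, projLoss h x l j + ‖h k y‖ := by gcongr
        _ = ∑ j ∈ s, projLoss h x (k :: l) j := by
          rw [projLoss, Finset.sum_update_of_mem hks, Finset.sdiff_singleton_eq_erase,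
            ← Finset.add_sum_erase s _ hks, projLoss_of_notMem x hkl, zero_add, add_comm]

/-- The detectability lemma of Aharonov, Arad, Landau and Vazirani. -/
theorem sum_norm_sq_projProd_le [Fintype S] (hh : ∀ i, IsStarProjection (h i)) {G : SimpleGraph S}
    [DecidableRel G.Adj] (hcomm : ∀ i j, ¬ G.Adj i j → Commute (h i) (h j)) {g : ℕ}
    (hg : ∀ i, G.degree i ≤ g) {l : List S} (hl : l.Nodup) (hl' : ∀ i, i ∈ l) (x : E) :
    ∑ i, ‖h i (projProd h l x)‖ ^ 2 ≤ (g : ℝ) ^ 2 * (‖x‖ ^ 2 - ‖projProd h l x‖ ^ 2) := by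
  have hterm : ∀ i, ‖h i (projProd h l x)‖ ^ 2 ≤
      g * ∑ j ∈ G.neighborFinset i, projLoss h x l j ^ 2 := fun i =>
    calc ‖h i (projProd h l x)‖ ^ 2 ≤ (∑ j ∈ G.neighborFinset i, projLoss h x l j) ^ 2 := by
          gcongr
          refine norm_apply_projProd_le hh x hl (hl' i) fun j hij => ?_
          exact (G.mem_neighborFinset i j).2 (not_imp_comm.1 (hcomm i j) hij)
      _ ≤ G.degree i * ∑ j ∈ G.neighborFinset i, projLoss h x l j ^ 2 := sq_sum_le_card_mul_sum_sq
      _ ≤ _ := by gcongr; exact hg i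
  calc ∑ i, ‖h i (projProd h l x)‖ ^ 2
      ≤ g * ∑ i, ∑ j ∈ G.neighborFinset i, projLoss h x l j ^ 2 := by
        rw [Finset.mul_sum]
        exact Finset.sum_le_sum fun i _ => hterm i
    _ = g * ∑ j, G.degree j * projLoss h x l j ^ 2 := by
        rw [Finset.sum_comm' (t' := Finset.univ) (s' := fun j => G.neighborFinset j)
          (by simp [SimpleGraph.adj_comm])]
        simp only [Finset.sum_const, SimpleGraph.card_neighborFinset_eq_degree, nsmul_eq_mul]
    _ ≤ g * ∑ j, g * projLoss h x l j ^ 2 := by gcongr with j; exact hg j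
    _ ≤ (g : ℝ) ^ 2 * (‖x‖ ^ 2 - ‖projProd h l x‖ ^ 2) := by
        rw [← Finset.mul_sum, ← mul_assoc, ← sq]
        gcongr
        exact sum_projLoss_sq_le hh x l

end Projections

section Layers

variable {S : Type*} [Fintype S] (G : SimpleGraph S) [DecidableRel G.Adj] {g : ℕ}

theorem colorable_succ_of_degree_le (hg : ∀ i, G.degree i ≤ g) : G.Colorable (g + 1) := by
  classical
  suffices greedy : ∀ s : Finset S, ∃ c : S → Fin (g + 1),
      ∀ i ∈ s, ∀ j ∈ s, G.Adj i j → c i ≠ c j by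
    obtain ⟨c, hc⟩ := greedy Finset.univ
    exact ⟨.mk c fun hij => hc _ (Finset.mem_univ _) _ (Finset.mem_univ _) hij⟩
  intro s
  induction s using Finset.induction_on with
  | empty => exact ⟨fun _ => 0, by simp⟩
  | insert a s _ ih =>
    obtain ⟨c, hc⟩ := ih
    obtain ⟨k, -, hk⟩ : ∃ k ∈ Finset.univ, k ∉ (G.neighborFinset a).image c := by
      refine Finset.exists_mem_notMem_of_card_lt_card (Finset.card_image_le.trans_lt ?_)
      simpa using Nat.lt_succ_of_le (hg a)
    have hfree : ∀ j, G.Adj a j → c j ≠ k := fun j hj hjk =>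
      hk (Finset.mem_image.2 ⟨j, by simpa using hj, hjk⟩)
    refine ⟨Function.update c a k, fun i hi j hj hij => ?_⟩
    have := hij.ne
    have := hfree i
    have := hfree j
    have := hij.symm
    grind

/-- Take the colour classes of a proper colouring with `g + 1` colours. -/
theorem exists_layers (hg : ∀ i, G.degree i ≤ g) : ∃ ws : List (List S), ws.length = g + 1 ∧
    (∀ l ∈ ws, ∀ i ∈ l, ∀ j ∈ l, ¬ G.Adj i j) ∧ ws.flatten.Nodup ∧ ∀ i, i ∈ ws.flatten := by
  classical
  obtain ⟨c⟩ := colorable_succ_of_degree_le G hg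
  let layer (k : Fin (g + 1)) : List S := (Finset.univ.filter fun i => c i = k).toList
  have mem_layer : ∀ {i k}, i ∈ layer k ↔ c i = k := by simp [layer]
  refine ⟨(List.finRange (g + 1)).map layer, by simp, ?_, ?_, ?_⟩
  · simp only [List.forall_mem_map, mem_layer]
    exact fun k _ i hi j hj hij => c.valid hij (hi.trans hj.symm)
  · refine List.nodup_flatten.2 ⟨?_, List.pairwise_map.2 ?_⟩
    · exact List.forall_mem_map.2 fun k _ => Finset.nodup_toList _
    · refine (List.nodup_finRange _).imp fun hab i hia hib => hab ?_
      rw [← mem_layer.1 hia, ← mem_layer.1 hib]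
  · exact fun i => List.mem_flatten.2
      ⟨layer (c i), List.mem_map.2 ⟨c i, List.mem_finRange _, rfl⟩, mem_layer.2 rfl⟩

end Layers

section LightCones

variable {𝕜 E S : Type*} [RCLike 𝕜] [NormedAddCommGroup E] [InnerProductSpace 𝕜 E]

/-- The labels within distance `t` of a label whose term does not commute with `O`. -/
def lightCone (h : S → E →L[𝕜] E) (G : SimpleGraph S) (O : E →L[𝕜] E) (t : ℕ) : Set S :=
  {i | ∃ j, ¬ Commute O (h j) ∧ G.edist j i ≤ t}

/-- The vectors that arise from `O ψ` by complementary projections with labels in the light cone. -/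
def lightConeOrbit (h : S → E →L[𝕜] E) (G : SimpleGraph S) (O : E →L[𝕜] E) (ψ : E) (t : ℕ) :
    Set E :=
  {x | ∃ l : List S, (∀ i ∈ l, i ∈ lightCone h G O t) ∧ projProd h l (O ψ) = x}

variable {h : S → E →L[𝕜] E} {G : SimpleGraph S} {O : E →L[𝕜] E} {ψ : E}

theorem commute_of_notMem_lightCone {t : ℕ} {i : S} (hi : i ∉ lightCone h G O t) :
    Commute O (h i) := by
  by_contra hO
  exact hi ⟨i, hO, by simp⟩

theorem mem_lightCone_succ {t : ℕ} {i : S} (hi : i ∈ lightCone h G O t) :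
    i ∈ lightCone h G O (t + 1) := by
  obtain ⟨k, hk, hki⟩ := hi
  exact ⟨k, hk, hki.trans (by exact_mod_cast t.le_succ)⟩

theorem mem_lightCone_succ_of_adj {t : ℕ} {i j : S} (hi : i ∈ lightCone h G O t)
    (hij : G.Adj i j) : j ∈ lightCone h G O (t + 1) := by
  obtain ⟨k, hk, hki⟩ := hi
  refine ⟨k, hk, (G.edist_triangle (v := i)).trans ?_⟩
  rw [SimpleGraph.edist_eq_one_iff_adj.2 hij]
  exact_mod_cast add_le_add_left hki 1

/-- A term outside of the light cone can be commuted through `O` to `ψ`, which it annihilates. -/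
theorem apply_projProd_eq_zero_of_notMem_lightCone (hψ : ∀ i, h i ψ = 0) {i : S} {l : List S}
    {t : ℕ} (hi : i ∉ lightCone h G O t) (hl : ∀ j ∈ l, Commute (h i) (h j)) :
    h i (projProd h l (O ψ)) = 0 := by
  have hcomm : Commute (h i) (projProd h l * O) :=
    (commute_projProd hl).mul_right (commute_of_notMem_lightCone hi).symm
  rw [← mul_apply_eq_comp, ← mul_apply_eq_comp, mul_assoc, hcomm.eq, mul_apply_eq_comp, hψ,
    map_zero]

theorem mapsTo_projProd_lightConeOrbit (hψ : ∀ i, h i ψ = 0)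
    (hcomm : ∀ i j, ¬ G.Adj i j → Commute (h i) (h j)) {l : List S}
    (hl : ∀ i ∈ l, ∀ j ∈ l, ¬ G.Adj i j) (t : ℕ) :
    Set.MapsTo ⇑(projProd h l) (lightConeOrbit h G O ψ t) (lightConeOrbit h G O ψ (t + 1)) := by
  classical
  rintro _ ⟨l', hl', rfl⟩
  refine ⟨l.filter (· ∈ lightCone h G O (t + 1)) ++ l', fun i hi => ?_, ?_⟩
  · rcases List.mem_append.1 hi with hi | hi
    · exact of_decide_eq_true (List.mem_filter.1 hi).2
    · exact mem_lightCone_succ (hl' i hi)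
  induction l with
  | nil => simp
  | cons i l ih =>
    specialize ih fun j hj k hk => hl j (.tail _ hj) k (.tail _ hk)
    rw [projProd_cons, mul_apply_eq_comp, ← ih]
    by_cases hi : i ∈ lightCone h G O (t + 1)
    · simp [hi]
    rw [List.filter_cons_of_neg (by simpa using hi), sub_apply, one_apply_eq_self,
      apply_projProd_eq_zero_of_notMem_lightCone hψ hi, sub_zero]
    intro j hj
    rcases List.mem_append.1 hj with hj | hj
    · exact hcomm i j (hl i (.head _) j (.tail _ (List.mem_of_mem_filter hj)))
    · exact hcomm i j fun hij => hi (mem_lightCone_succ_of_adj (hl' j hj) hij.symm)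

theorem mapsTo_projProd_flatten_lightConeOrbit (hψ : ∀ i, h i ψ = 0)
    (hcomm : ∀ i j, ¬ G.Adj i j → Commute (h i) (h j)) {ws : List (List S)}
    (hws : ∀ l ∈ ws, ∀ i ∈ l, ∀ j ∈ l, ¬ G.Adj i j) (t : ℕ) :
    Set.MapsTo ⇑(projProd h ws.flatten) (lightConeOrbit h G O ψ t)
      (lightConeOrbit h G O ψ (t + ws.length)) := by
  induction ws with
  | nil => simpa using Set.mapsTo_id _
  | cons l ws ih =>
    rw [List.flatten_cons, projProd_append]
    exact (mapsTo_projProd_lightConeOrbit hψ hcomm (hws l (.head _)) _).comp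
      (ih fun l' hl' => hws l' (.tail _ hl'))

theorem pow_apply_mem_lightConeOrbit {T : E →L[𝕜] E} {r : ℕ}
    (hT : ∀ t, Set.MapsTo T (lightConeOrbit h G O ψ t) (lightConeOrbit h G O ψ (t + r))) (n : ℕ) :
    (T ^ n) (O ψ) ∈ lightConeOrbit h G O ψ (r * n) := by
  induction n with
  | zero => exact ⟨[], by simp, by simp⟩
  | succ n ih =>
    rw [pow_succ', mul_apply_eq_comp, Nat.mul_succ]
    exact hT _ ih

variable [CompleteSpace E]

theorem mapsTo_star_mul_self_lightConeOrbit (hh : ∀ i, IsStarProjection (h i))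
    (hψ : ∀ i, h i ψ = 0) (hcomm : ∀ i j, ¬ G.Adj i j → Commute (h i) (h j)) {ws : List (List S)}
    (hws : ∀ l ∈ ws, ∀ i ∈ l, ∀ j ∈ l, ¬ G.Adj i j) (t : ℕ) :
    Set.MapsTo (star (projProd h ws.flatten) * projProd h ws.flatten)
      (lightConeOrbit h G O ψ t) (lightConeOrbit h G O ψ (t + 2 * ws.length)) := by
  have hrev : ∀ l ∈ (ws.map List.reverse).reverse, ∀ i ∈ l, ∀ j ∈ l, ¬ G.Adj i j := by
    simp only [List.mem_reverse, List.forall_mem_map]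
    exact hws
  rw [star_projProd hh, List.reverse_flatten]
  have hstar := mapsTo_projProd_flatten_lightConeOrbit (O := O) hψ hcomm hrev (t + ws.length)
  rw [List.length_reverse, List.length_map, add_assoc, ← two_mul] at hstar
  exact hstar.comp (mapsTo_projProd_flatten_lightConeOrbit hψ hcomm hws t)

theorem inner_of_mem_lightConeOrbit (hh : ∀ i, IsStarProjection (h i)) {χ x : E} {t : ℕ}
    (hχ : ∀ i ∈ lightCone h G O t, h i χ = 0) (hx : x ∈ lightConeOrbit h G O ψ t) :
    ⟪χ, x⟫_𝕜 = ⟪χ, O ψ⟫_𝕜 := by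
  obtain ⟨l, hl, rfl⟩ := hx
  exact inner_projProd_apply hh (fun i hi => hχ i (hl i hi)) _

theorem apply_star_apply_eq_zero_of_mem_lightCone (hh : ∀ i, IsStarProjection (h i))
    (hψ : ∀ i, h i ψ = 0) {O' : E →L[𝕜] E} {t : ℕ}
    (hfar : ∀ i j, ¬ Commute O' (h i) → ¬ Commute O (h j) → (t : ℕ∞) < G.edist i j) {i : S}
    (hi : i ∈ lightCone h G O t) : h i (star O' ψ) = 0 := by
  obtain ⟨j, hj, hji⟩ := hi
  have hO' : Commute O' (h i) := by
    by_contra hO'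
    exact (hfar i j hO' hj).not_ge (SimpleGraph.edist_comm.trans_le hji)
  have hstar : Commute (star O') (h i) := by
    simpa only [(hh i).isSelfAdjoint.star_eq] using hO'.star_star
  rw [← mul_apply_eq_comp, ← hstar.eq, mul_apply_eq_comp, hψ, map_zero]

end LightCones

section Polynomials

theorem norm_aeval_star_mul_self_le {A : Type*} [CStarAlgebra A] [Nontrivial A] (a : A) {q c : ℝ}
    (ha : ‖a‖ ^ 2 ≤ q) (hc : 0 ≤ c) {P : Polynomial ℝ} (hP : ∀ x ∈ Set.Icc 0 q, |P.eval x| ≤ c) :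
    ‖Polynomial.aeval (star a * a) P‖ ≤ c := by
  rw [← cfc_polynomial P _ (IsSelfAdjoint.star_mul_self a)]
  refine norm_cfc_le hc fun x hx => hP x ⟨spectrum_star_mul_self_nonneg x hx, ?_⟩
  calc x ≤ ‖star a * a‖ := (le_abs_self x).trans (spectrum.norm_le_norm_of_mem hx)
    _ ≤ q := by rwa [CStarRing.norm_star_mul_self, ← sq]

variable {E : Type*} [NormedAddCommGroup E] [InnerProductSpace ℂ E]

theorem aeval_apply_eq_sum_range (T : E →L[ℂ] E) (P : Polynomial ℝ) (x : E) :
    Polynomial.aeval T P x =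
      ∑ j ∈ Finset.range (P.natDegree + 1), (P.coeff j : ℂ) • (T ^ j) x := by
  rw [← Polynomial.aeval_map_algebraMap ℂ, Polynomial.aeval_eq_sum_range, Polynomial.natDegree_map]
  simp

theorem aeval_apply_congr {T T' : E →L[ℂ] E} {K : Set E} (hK : Set.MapsTo T K K)
    (hT : Set.EqOn T' T K) (P : Polynomial ℝ) {x : E} (hx : x ∈ K) :
    Polynomial.aeval T' P x = Polynomial.aeval T P x := by
  have hpow : ∀ n : ℕ, (T' ^ n) x = (T ^ n) x ∧ (T ^ n) x ∈ K := by
    intro n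
    induction n with
    | zero => simpa using hx
    | succ n ih =>
      rw [pow_succ', pow_succ', mul_apply_eq_comp, mul_apply_eq_comp, ih.1]
      exact ⟨hT ih.2, hK ih.2⟩
  simp only [aeval_apply_eq_sum_range, (hpow _).1]

theorem aeval_apply_of_apply_eq_self {T : E →L[ℂ] E} {x : E} (hx : T x = x) (P : Polynomial ℝ) :
    Polynomial.aeval T P x = ((P.eval 1 : ℝ) : ℂ) • x := by
  have hpow : ∀ j : ℕ, (T ^ j) x = x := fun j => by
    induction j with
    | zero => simp
    | succ j ih => rw [pow_succ, mul_apply_eq_comp, hx, ih]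
  rw [aeval_apply_eq_sum_range, Polynomial.eval_eq_sum_range, Complex.ofReal_sum, Finset.sum_smul]
  simp [hpow]

theorem inner_aeval_apply_of_forall_pow {T : E →L[ℂ] E} {P : Polynomial ℝ} {χ x : E}
    (hT : ∀ j ≤ P.natDegree, ⟪χ, (T ^ j) x⟫_ℂ = ⟪χ, x⟫_ℂ) :
    ⟪χ, Polynomial.aeval T P x⟫_ℂ = (P.eval 1 : ℝ) * ⟪χ, x⟫_ℂ := by
  rw [aeval_apply_eq_sum_range, inner_sum, Polynomial.eval_eq_sum_range, Complex.ofReal_sum,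
    Finset.sum_mul]
  refine Finset.sum_congr rfl fun j hj => ?_
  rw [inner_smul_right, hT j (Finset.mem_range_succ_iff.1 hj), one_pow, mul_one]

variable [CompleteSpace E]

theorem norm_aeval_star_mul_self_apply_le (D : E →L[ℂ] E) {K : Submodule ℂ E}
    [K.HasOrthogonalProjection] (hK : Set.MapsTo (star D * D) K K) {q c : ℝ} (hq : 0 ≤ q)
    (hD : ∀ x ∈ K, ‖D x‖ ^ 2 ≤ q * ‖x‖ ^ 2) (hc : 0 ≤ c) {P : Polynomial ℝ}
    (hP : ∀ x ∈ Set.Icc 0 q, |P.eval x| ≤ c) {x : E} (hx : x ∈ K) :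
    ‖Polynomial.aeval (star D * D) P x‖ ≤ c * ‖x‖ := by
  rcases subsingleton_or_nontrivial E with _ | _
  · simp [Subsingleton.elim x 0]
  have hnorm : ‖D * K.starProjection‖ ^ 2 ≤ q := by
    refine (Real.le_sqrt (norm_nonneg _) hq).1 ?_
    refine ContinuousLinearMap.opNorm_le_bound _ (Real.sqrt_nonneg _) fun y => ?_
    rw [mul_apply_eq_comp, ← Real.sqrt_sq (norm_nonneg y), ← Real.sqrt_mul hq]
    refine Real.le_sqrt_of_sq_le ((hD _ (K.starProjection_apply_mem y)).trans ?_)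
    gcongr
    exact K.norm_starProjection_apply_le y
  have hEqOn : Set.EqOn ⇑(star (D * K.starProjection) * (D * K.starProjection))
      ⇑(star D * D) K := by
    intro y hy
    have hfix : ∀ z ∈ K, K.starProjection z = z := fun z => Submodule.starProjection_eq_self_iff.2
    rw [star_mul, isStarProjection_starProjection.isSelfAdjoint.star_eq]
    calc K.starProjection (star D (D (K.starProjection y)))
        = K.starProjection ((star D * D) y) := by rw [hfix y hy, mul_apply_eq_comp]
      _ = (star D * D) y := hfix _ (hK hy)
  rw [← aeval_apply_congr hK hEqOn P hx]
  exact ContinuousLinearMap.le_of_opNorm_le _ (norm_aeval_star_mul_self_le _ hnorm hc hP) x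

/-- The Chebyshev polynomial `T_m(2 cosh² η X - 1)`, rescaled to be `1` at `1`. It is small on
`[0, 1 / cosh² η]`, where the argument of `T_m` lies in `[-1, 1]`. -/
noncomputable def stepPolynomial (m : ℕ) (η : ℝ) : Polynomial ℝ :=
  Polynomial.C (Real.cosh (m * (2 * η)))⁻¹ *
    (Polynomial.Chebyshev.T ℝ m).comp (Polynomial.C (2 * Real.cosh η ^ 2) * Polynomial.X - 1)

theorem eval_stepPolynomial (m : ℕ) (η x : ℝ) : (stepPolynomial m η).eval x =
    (Real.cosh (m * (2 * η)))⁻¹ *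
      (Polynomial.Chebyshev.T ℝ m).eval (2 * Real.cosh η ^ 2 * x - 1) := by
  simp [stepPolynomial]

theorem eval_one_stepPolynomial (m : ℕ) (η : ℝ) : (stepPolynomial m η).eval 1 = 1 := by
  have hcosh : 2 * Real.cosh η ^ 2 * 1 - 1 = Real.cosh (2 * η) := by
    rw [Real.cosh_two_mul, Real.sinh_sq]; ring
  have hT := Polynomial.Chebyshev.T_real_cosh (2 * η) m
  rw [eval_stepPolynomial, hcosh, hT]
  exact inv_mul_cancel₀ (Real.cosh_pos _).ne'

theorem abs_eval_stepPolynomial_le (m : ℕ) (η : ℝ) {x : ℝ}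
    (hx : x ∈ Set.Icc 0 (Real.cosh η ^ 2)⁻¹) :
    |(stepPolynomial m η).eval x| ≤ (Real.cosh (m * (2 * η)))⁻¹ := by
  have hpos : 0 < Real.cosh η ^ 2 := pow_pos (Real.cosh_pos η) 2
  have hle : Real.cosh η ^ 2 * x ≤ 1 := (le_inv_mul_iff₀ hpos).1 (by simpa using hx.2)
  have hnonneg : 0 ≤ Real.cosh η ^ 2 * x := mul_nonneg hpos.le hx.1
  have hT := Polynomial.Chebyshev.abs_eval_T_real_le_one m
    (x := 2 * Real.cosh η ^ 2 * x - 1) (abs_le.2 ⟨by linarith, by linarith⟩)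
  rw [eval_stepPolynomial, abs_mul, abs_of_pos (inv_pos.2 (Real.cosh_pos _))]
  exact mul_le_of_le_one_right (inv_pos.2 (Real.cosh_pos _)).le hT

theorem natDegree_stepPolynomial_le (m : ℕ) (η : ℝ) : (stepPolynomial m η).natDegree ≤ m := by
  have hlin : (Polynomial.C (2 * Real.cosh η ^ 2) * Polynomial.X - 1 :
      Polynomial ℝ).natDegree ≤ 1 := by
    compute_degree
  calc (stepPolynomial m η).natDegree
      ≤ _ := (Polynomial.natDegree_C_mul_le _ _).trans Polynomial.natDegree_comp_le
    _ ≤ m * 1 := Nat.mul_le_mul (by simp) hlin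
    _ = m := mul_one m

end Polynomials

section Decay

section RCLike

variable {𝕜 E S : Type*} [RCLike 𝕜] [NormedAddCommGroup E] [InnerProductSpace 𝕜 E]
  [CompleteSpace E]

/-- The energy of `D x`, with `D` the product of the complementary projections, is at least
`γ ‖D x‖²` by the gap, and at most `g² (‖x‖² - ‖D x‖²)` by the detectability lemma. -/
theorem one_add_mul_norm_sq_projProd_le [Fintype S] {h : S → E →L[𝕜] E}
    (hh : ∀ i, IsStarProjection (h i)) {ψ : E} (hψ : ∀ i, h i ψ = 0) {G : SimpleGraph S}
    [DecidableRel G.Adj] (hcomm : ∀ i j, ¬ G.Adj i j → Commute (h i) (h j)) {g : ℕ}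
    (hg : ∀ i, G.degree i ≤ g) {γ : ℝ}
    (hgap : ∀ x ∈ (𝕜 ∙ ψ)ᗮ, γ * ‖x‖ ^ 2 ≤ ∑ i, ‖h i x‖ ^ 2) {l : List S} (hl : l.Nodup)
    (hl' : ∀ i, i ∈ l) {s : ℝ} (hs : ((g : ℝ) + 1) ^ 2 * s ≤ γ) {x : E} (hx : x ∈ (𝕜 ∙ ψ)ᗮ) :
    (1 + s) * ‖projProd h l x‖ ^ 2 ≤ ‖x‖ ^ 2 := by
  have hperp : projProd h l x ∈ (𝕜 ∙ ψ)ᗮ := by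
    rw [Submodule.mem_orthogonal_singleton_iff_inner_right] at hx ⊢
    rw [inner_projProd_apply hh fun i _ => hψ i, hx]
  have hnonneg : 0 ≤ ‖x‖ ^ 2 - ‖projProd h l x‖ ^ 2 :=
    (Finset.sum_nonneg fun j _ => sq_nonneg (projLoss h x l j)).trans (sum_projLoss_sq_le hh x l)
  have hscaled : ((g : ℝ) + 1) ^ 2 * (s * ‖projProd h l x‖ ^ 2) ≤
      ((g : ℝ) + 1) ^ 2 * (‖x‖ ^ 2 - ‖projProd h l x‖ ^ 2) :=
    calc ((g : ℝ) + 1) ^ 2 * (s * ‖projProd h l x‖ ^ 2) ≤ γ * ‖projProd h l x‖ ^ 2 := by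
          rw [← mul_assoc]; gcongr
      _ ≤ ∑ i, ‖h i (projProd h l x)‖ ^ 2 := hgap _ hperp
      _ ≤ (g : ℝ) ^ 2 * (‖x‖ ^ 2 - ‖projProd h l x‖ ^ 2) :=
        sum_norm_sq_projProd_le hh hcomm hg hl hl' x
      _ ≤ ((g : ℝ) + 1) ^ 2 * (‖x‖ ^ 2 - ‖projProd h l x‖ ^ 2) := by gcongr; linarith
  linarith [le_of_mul_le_mul_left hscaled (by positivity)]

/-- An operator `A` that fixes `ψ`, is small on `ψ^⊥`, and does not change the correlator of `O` and
`O'` can be inserted between them. -/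
theorem norm_inner_sub_inner_mul_inner_le {ψ : E} (hψ : ‖ψ‖ = 1) {O O' A : E →L[𝕜] E}
    (hAψ : A ψ = ψ) (hA : ⟪star O ψ, A (O' ψ)⟫_𝕜 = ⟪star O ψ, O' ψ⟫_𝕜) {c : ℝ} (hc : 0 ≤ c)
    (hAc : ∀ x ∈ (𝕜 ∙ ψ)ᗮ, ‖A x‖ ≤ c * ‖x‖) :
    ‖⟪ψ, O (O' ψ)⟫_𝕜 - ⟪ψ, O ψ⟫_𝕜 * ⟪ψ, O' ψ⟫_𝕜‖ ≤ c * (‖star O ψ‖ * ‖O' ψ‖) := by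
  set w := (𝕜 ∙ ψ)ᗮ.starProjection (O' ψ) with hw
  have hw_eq : w = O' ψ - ⟪ψ, O' ψ⟫_𝕜 • ψ := by
    rw [hw, Submodule.starProjection_orthogonal, ← Submodule.starProjection_unit_singleton 𝕜 hψ]
    rfl
  have hadj : ∀ y, ⟪star O ψ, y⟫_𝕜 = ⟪ψ, O y⟫_𝕜 := fun y => by
    rw [ContinuousLinearMap.star_eq_adjoint, ContinuousLinearMap.adjoint_inner_left]
  calc ‖⟪ψ, O (O' ψ)⟫_𝕜 - ⟪ψ, O ψ⟫_𝕜 * ⟪ψ, O' ψ⟫_𝕜‖ = ‖⟪star O ψ, A w⟫_𝕜‖ := by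
        rw [hw_eq, map_sub, map_smul, hAψ, inner_sub_right, inner_smul_right, hA, hadj, hadj,
          mul_comm]
    _ ≤ ‖star O ψ‖ * (c * ‖O' ψ‖) := by
        refine (norm_inner_le_norm _ _).trans ?_
        gcongr
        refine (hAc w (Submodule.starProjection_apply_mem _ _)).trans ?_
        gcongr
        exact Submodule.norm_starProjection_apply_le _ _
    _ = c * (‖star O ψ‖ * ‖O' ψ‖) := by ring

end RCLike

theorem norm_correlation_le {E S : Type*} [NormedAddCommGroup E] [InnerProductSpace ℂ E]
    [CompleteSpace E] [Fintype S] {h : S → E →L[ℂ] E} (hh : ∀ i, IsStarProjection (h i)) {ψ : E}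
    (hψ1 : ‖ψ‖ = 1) (hψ : ∀ i, h i ψ = 0) {G : SimpleGraph S} [DecidableRel G.Adj]
    (hcomm : ∀ i j, ¬ G.Adj i j → Commute (h i) (h j)) {g : ℕ} (hg : ∀ i, G.degree i ≤ g) {γ : ℝ}
    (hgap : ∀ x ∈ (ℂ ∙ ψ)ᗮ, γ * ‖x‖ ^ 2 ≤ ∑ i, ‖h i x‖ ^ 2) {O O' : E →L[ℂ] E} {m : ℕ}
    (hfar : ∀ i j, ¬ Commute O (h i) → ¬ Commute O' (h j) →
      ((2 * (g + 1) * m : ℕ) : ℕ∞) < G.edist i j)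
    {η : ℝ} (hη : ((g : ℝ) + 1) ^ 2 * Real.sinh η ^ 2 ≤ γ) :
    ‖⟪ψ, O (O' ψ)⟫_ℂ - ⟪ψ, O ψ⟫_ℂ * ⟪ψ, O' ψ⟫_ℂ‖ ≤
      (Real.cosh (m * (2 * η)))⁻¹ * (‖star O ψ‖ * ‖O' ψ‖) := by
  obtain ⟨ws, hlength, hlayers, hnodup, hmem⟩ := exists_layers G hg
  set D := projProd h ws.flatten with hD
  have hDψ : D ψ = ψ := projProd_apply_eq_self fun i _ => hψ i
  have hD'ψ : star D ψ = ψ := by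
    rw [hD, star_projProd hh]; exact projProd_apply_eq_self fun i _ => hψ i
  have hTψ : (star D * D) ψ = ψ := by rw [mul_apply_eq_comp, hDψ, hD'ψ]
  have hperp : Set.MapsTo ⇑(star D * D) (ℂ ∙ ψ)ᗮ (ℂ ∙ ψ)ᗮ := by
    intro x hx
    rw [SetLike.mem_coe, Submodule.mem_orthogonal_singleton_iff_inner_right] at hx ⊢
    rw [mul_apply_eq_comp, ContinuousLinearMap.star_eq_adjoint,
      ContinuousLinearMap.adjoint_inner_right, hDψ, hD, inner_projProd_apply hh fun i _ => hψ i, hx]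
  have hcontract : ∀ x ∈ (ℂ ∙ ψ)ᗮ, ‖D x‖ ^ 2 ≤ (Real.cosh η ^ 2)⁻¹ * ‖x‖ ^ 2 := fun x hx => by
    rw [le_inv_mul_iff₀ (pow_pos (Real.cosh_pos η) 2), Real.cosh_sq' η]
    exact one_add_mul_norm_sq_projProd_le hh hψ hcomm hg hgap hnodup hmem hη hx
  have hpow : ∀ j ≤ (stepPolynomial m η).natDegree,
      ⟪star O ψ, ((star D * D) ^ j) (O' ψ)⟫_ℂ = ⟪star O ψ, O' ψ⟫_ℂ := fun j hj => by
    refine inner_of_mem_lightConeOrbit hh (fun i hi => ?_) (pow_apply_mem_lightConeOrbit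
      (mapsTo_star_mul_self_lightConeOrbit hh hψ hcomm hlayers) j)
    refine apply_star_apply_eq_zero_of_mem_lightCone hh hψ (fun i k hi hk => ?_) hi
    refine lt_of_le_of_lt ?_ (hfar i k hi hk)
    rw [hlength]
    exact_mod_cast Nat.mul_le_mul_left _ (hj.trans (natDegree_stepPolynomial_le m η))
  have hcosh : 0 ≤ (Real.cosh (m * (2 * η)))⁻¹ := (inv_pos.2 (Real.cosh_pos _)).le
  refine norm_inner_sub_inner_mul_inner_le (A := Polynomial.aeval (star D * D) (stepPolynomial m η))
    hψ1 ?_ ?_ hcosh fun x hx => ?_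
  · rw [aeval_apply_of_apply_eq_self hTψ, eval_one_stepPolynomial, Complex.ofReal_one, one_smul]
  · rw [inner_aeval_apply_of_forall_pow hpow, eval_one_stepPolynomial, Complex.ofReal_one, one_mul]
  · exact norm_aeval_star_mul_self_apply_le D hperp (by positivity) hcontract hcosh
      (fun y hy => abs_eval_stepPolynomial_le m η hy) hx

end Decay

/-! ### Operators on a region -/

section Region

variable {V : Type*} [DecidableEq V] {d : V → ℕ} {R : Finset V}

/-- The configuration that agrees with `a` on the region `R` and with `s` outside `R`. -/
def patch (s : Conf d) (a : RegionConf d R) : Conf d :=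
  glue a fun v => s v

theorem patch_of_mem (s : Conf d) (a : RegionConf d R) {v : V} (hv : v ∈ R) :
    patch s a v = a ⟨v, hv⟩ :=
  dif_pos hv

theorem patch_of_notMem (s : Conf d) (a : RegionConf d R) {v : V} (hv : v ∉ R) :
    patch s a v = s v :=
  dif_neg hv

theorem patch_apply_congr {s s' : Conf d} (a : RegionConf d R) {v : V} (h : v ∉ R → s v = s' v) :
    patch s a v = patch s' a v := by
  by_cases hv : v ∈ R
  · rw [patch_of_mem s a hv, patch_of_mem s' a hv]
  · rw [patch_of_notMem s a hv, patch_of_notMem s' a hv, h hv]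

theorem restrict_patch (s : Conf d) (a : RegionConf d R) :
    (fun v : {v // v ∈ R} => patch s a v) = a :=
  funext fun v => patch_of_mem s a v.2

theorem restrict_glue (a : RegionConf d R) (c : OutsideConf d R) :
    (fun v : {v // v ∈ R} => glue a c v) = a :=
  funext fun v => dif_pos v.2

theorem patch_glue (a b : RegionConf d R) (c : OutsideConf d R) :
    patch (glue a c) b = glue b c := by
  ext v
  by_cases hv : v ∈ R <;> simp [patch, glue, hv]

theorem patch_injective (s : Conf d) : Function.Injective (patch s : RegionConf d R → Conf d) :=
  fun a b h => by rw [← restrict_patch s a, h, restrict_patch]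

theorem patch_eq_self {s : Conf d} {a : RegionConf d R} (h : ∀ v : {v // v ∈ R}, a v = s v) :
    patch s a = s := by
  ext v
  by_cases hv : v ∈ R
  · rw [patch_of_mem s a hv, h]
  · rw [patch_of_notMem s a hv]

theorem patch_patch (s : Conf d) (a b : RegionConf d R) : patch (patch s a) b = patch s b := by
  ext v
  by_cases hv : v ∈ R
  · rw [patch_of_mem _ b hv, patch_of_mem _ b hv]
  · rw [patch_of_notMem _ b hv, patch_of_notMem _ b hv, patch_of_notMem _ a hv]

theorem patch_comm {R' : Finset V} (hR : Disjoint R R') (s : Conf d) (a : RegionConf d R)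
    (a' : RegionConf d R') : patch (patch s a) a' = patch (patch s a') a := by
  ext v
  have hv : v ∈ R → v ∉ R' := fun h => Finset.disjoint_left.1 hR h
  by_cases v ∈ R <;> by_cases v ∈ R' <;> simp_all [patch, glue]

variable [Fintype V]

theorem extendOp_mulVec (M : Matrix (RegionConf d R) (RegionConf d R) ℂ) (φ : Conf d → ℂ)
    (s : Conf d) :
    (extendOp R M *ᵥ φ) s = (M *ᵥ fun a => φ (patch s a)) fun v => s v := by
  refine (Fintype.sum_of_injective (patch s) (patch_injective s) _ _ (fun t ht => ?_)
    fun a => ?_).symm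
  · have hst : ¬ ∀ v, v ∉ R → s v = t v := by
      refine fun h => ht ⟨fun v => t v, funext fun v => ?_⟩
      by_cases hv : v ∈ R
      · rw [patch_of_mem _ _ hv]
      · rw [patch_of_notMem _ _ hv, h v hv]
    simp only [extendOp, if_neg hst, zero_mul]
  · simp only [extendOp, restrict_patch,
      if_pos fun v hv => (patch_of_notMem s a hv : patch s a v = s v).symm]

theorem extendOp_mul (M N : Matrix (RegionConf d R) (RegionConf d R) ℂ) :
    extendOp R (M * N) = extendOp R M * extendOp R N := by
  refine Matrix.ext_of_mulVec_single fun t => funext fun s => ?_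
  rw [← Matrix.mulVec_mulVec]
  simp only [extendOp_mulVec, restrict_patch, patch_patch, ← Matrix.mulVec_mulVec]

theorem extendOp_conjTranspose (M : Matrix (RegionConf d R) (RegionConf d R) ℂ) :
    (extendOp R M)ᴴ = extendOp R Mᴴ := by
  ext s t
  simp only [Matrix.conjTranspose_apply, extendOp, apply_ite star, star_zero, eq_comm]

theorem isStarProjection_extendOp {M : Matrix (RegionConf d R) (RegionConf d R) ℂ}
    (hM : IsStarProjection M) : IsStarProjection (extendOp R M) where
  isIdempotentElem := by rw [IsIdempotentElem, ← extendOp_mul, hM.isIdempotentElem.eq]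
  isSelfAdjoint := by
    rw [IsSelfAdjoint, Matrix.star_eq_conjTranspose, extendOp_conjTranspose,
      ← Matrix.star_eq_conjTranspose, hM.isSelfAdjoint.star_eq]

theorem isStarProjection_localProjector (ψ : StateSpace d) (R : Finset V) :
    IsStarProjection (localProjector ψ R) :=
  IsStarProjection.map (F := _ ≃⋆ₐ[ℂ] _)
    (isStarProjection_starProjection (U := (opSupport (reducedDensity ψ R))ᗮ)) _

theorem isStarProjection_parentTerm {S : Type*} (ψ : StateSpace d) (R : S → Finset V) (i : S) :
    IsStarProjection (parentTerm ψ R i) :=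
  isStarProjection_extendOp (isStarProjection_localProjector ψ (R i))

/-- The vector on the region `R` obtained from `φ` by fixing the configuration outside `R`. -/
noncomputable def slice (φ : StateSpace d) (R : Finset V) (c : OutsideConf d R) :
    EuclideanSpace ℂ (RegionConf d R) :=
  WithLp.toLp 2 fun a => φ (glue a c)

open scoped ComplexOrder in
/-- With `W c a = conj (ψ (glue a c))` the reduced density matrix is `Wᴴ * W`, so its kernel is
that of `W`, the orthogonal complement of the slices of `ψ`. -/
theorem opSupport_reducedDensity (ψ : StateSpace d) (R : Finset V) :
    opSupport (reducedDensity ψ R) = Submodule.span ℂ (Set.range (slice ψ R)) := by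
  set W : Matrix (OutsideConf d R) (RegionConf d R) ℂ :=
    .of fun c a => star (ψ (glue a c)) with hWdef
  have hW : reducedDensity ψ R = Wᴴ * W := by
    ext a b
    simp only [reducedDensity, Matrix.mul_apply, Matrix.conjTranspose_apply, hWdef,
      Matrix.of_apply, star_star]
  rw [← Submodule.orthogonal_orthogonal (Submodule.span ℂ _), opSupport]
  congr 1
  ext x
  rw [Submodule.mem_orthogonal, LinearMap.mem_ker]
  change toOp (reducedDensity ψ R) x = 0 ↔ _
  rw [← WithLp.ofLp_eq_zero 2, Matrix.ofLp_toEuclideanCLM, hW,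
    Matrix.conjTranspose_mul_self_mulVec_eq_zero, funext_iff]
  have hWx (c : OutsideConf d R) : ⟪slice ψ R c, x⟫_ℂ = (W *ᵥ x) c := by
    rw [EuclideanSpace.inner_eq_star_dotProduct, dotProduct_comm]
    rfl
  simp only [Pi.zero_apply, ← hWx]
  refine ⟨fun h u hu => ?_, fun h c => h _ (Submodule.subset_span ⟨c, rfl⟩)⟩
  obtain ⟨a, rfl⟩ := (Submodule.mem_span_range_iff_exists_fun ℂ).1 hu
  simp only [sum_inner, inner_smul_left, h, mul_zero, Finset.sum_const_zero]

theorem toOp_parentTerm_apply_eq_zero_iff {S : Type*} (ψ φ : StateSpace d) (R : S → Finset V)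
    (i : S) : toOp (parentTerm ψ R i) φ = 0 ↔
      ∀ c, slice φ (R i) c ∈ Submodule.span ℂ (Set.range (slice ψ (R i))) := by
  have slice_mem (c) : slice φ (R i) c ∈ opSupport (reducedDensity ψ (R i)) ↔
      (localProjector ψ (R i) *ᵥ fun a => φ (glue a c)) = 0 := by
    rw [← WithLp.ofLp_toLp 2 fun a => φ (glue a c), ← Matrix.ofLp_toEuclideanCLM, localProjector,
      StarAlgEquiv.apply_symm_apply, WithLp.ofLp_eq_zero,
      Submodule.starProjection_apply_eq_zero_iff, Submodule.orthogonal_orthogonal, slice]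
  simp only [← opSupport_reducedDensity, slice_mem, ← WithLp.ofLp_eq_zero 2 (x := toOp _ _),
    Matrix.ofLp_toEuclideanCLM, parentTerm, funext_iff, extendOp_mulVec, Pi.zero_apply]
  refine ⟨fun h c a => ?_, fun h s => h _ _⟩
  simpa only [patch_glue, restrict_glue] using h (glue a c)

theorem toOp_parentTerm_apply_self {S : Type*} (ψ : StateSpace d) (R : S → Finset V) (i : S) :
    toOp (parentTerm ψ R i) ψ = 0 :=
  (toOp_parentTerm_apply_eq_zero_iff ψ ψ R i).2 fun c => Submodule.subset_span ⟨c, rfl⟩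

end Region

/-! ### The spectral gap -/

section SpectralGap

open scoped ComplexOrder MatrixOrder

variable {ι S : Type*} [Fintype ι] [Fintype S] {H : S → Matrix ι ι ℂ}

theorem posSemidef_hamiltonian (hH : ∀ i, IsStarProjection (H i)) : (hamiltonian H).PosSemidef :=
  Matrix.posSemidef_sum _ fun i _ => Matrix.nonneg_iff_posSemidef.1 (hH i).nonneg

theorem hamiltonian_ne_zero (hH : ∀ i, IsStarProjection (H i)) (hL : linearSize H ≠ 0) :
    hamiltonian H ≠ 0 := by
  refine fun h0 => hL ?_
  have hzero (i : S) : H i = 0 :=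
    (Finset.sum_eq_zero_iff_of_nonneg fun i _ => (hH i).nonneg).1 h0 i (Finset.mem_univ i)
  have hbot : interactionGraph H = ⊥ := by
    ext i j
    simp [interactionGraph, hzero]
  rw [linearSize, hbot, SimpleGraph.diam_bot]

variable [DecidableEq ι]

theorem hasEigenvalue_toLin'_ofReal_iff {M : Matrix ι ι ℂ} (hM : M.IsHermitian) {r : ℝ} :
    Module.End.HasEigenvalue (Matrix.toLin' M) (r : ℂ) ↔ ∃ j, hM.eigenvalues j = r := by
  rw [Module.End.hasEigenvalue_iff_mem_spectrum, Matrix.spectrum_toLin', ← Set.mem_range,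
    ← hM.spectrum_real_eq_range_eigenvalues]
  exact spectrum.algebraMap_mem_iff ℂ (R := ℝ) (a := M)

theorem inner_toOp_apply_eq_sum {M : Matrix ι ι ℂ} (hM : M.IsHermitian) (x : EuclideanSpace ℂ ι) :
    ⟪x, toOp M x⟫_ℂ = ((∑ j, hM.eigenvalues j * ‖⟪hM.eigenvectorBasis j, x⟫_ℂ‖ ^ 2 : ℝ) : ℂ) := by
  have hsymm : (toOp M).toLinearMap.IsSymmetric := Matrix.isSymmetric_toEuclideanLin_iff.2 hM
  have hbasis (j : ι) : toOp M (hM.eigenvectorBasis j) =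
      (hM.eigenvalues j : ℂ) • hM.eigenvectorBasis j :=
    WithLp.ofLp_injective 2 (hM.mulVec_eigenvectorBasis j)
  rw [← hM.eigenvectorBasis.sum_inner_mul_inner x (toOp M x), Complex.ofReal_sum]
  refine Finset.sum_congr rfl fun j _ => ?_
  rw [← ContinuousLinearMap.coe_coe, ← hsymm, ContinuousLinearMap.coe_coe, hbasis,
    inner_smul_left, Complex.conj_ofReal, mul_left_comm, ← inner_conj_symm, RCLike.conj_mul]
  push_cast
  rfl

theorem spectralGap_nonneg {M : Matrix ι ι ℂ} (hM : M.PosSemidef) : 0 ≤ spectralGap M := by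
  refine Real.sInf_nonneg fun r hr => ?_
  obtain ⟨j, rfl⟩ := (hasEigenvalue_toLin'_ofReal_iff hM.isHermitian).1 hr.2
  exact hM.eigenvalues_nonneg j

theorem spectralGap_pos {M : Matrix ι ι ℂ} (hM : M.PosSemidef) (h0 : M ≠ 0) :
    0 < spectralGap M := by
  refine (spectralGap_nonneg hM).lt_of_ne'
    (Set.Nonempty.csInf_mem (α := ℝ) (s := {r | r ≠ 0 ∧ _}) ?_ ?_).1
  · obtain ⟨j, hj⟩ := Function.ne_iff.1 (hM.isHermitian.eigenvalues_eq_zero_iff.not.2 h0)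
    exact ⟨_, hj, (hasEigenvalue_toLin'_ofReal_iff hM.isHermitian).2 ⟨j, rfl⟩⟩
  · refine (Set.finite_range hM.isHermitian.eigenvalues).subset fun r hr => ?_
    exact (hasEigenvalue_toLin'_ofReal_iff hM.isHermitian).1 hr.2

theorem spectralGap_mul_norm_sq_le {M : Matrix ι ι ℂ} (hM : M.PosSemidef)
    {x : EuclideanSpace ℂ ι} (hx : x ∈ (LinearMap.ker (toOp M).toLinearMap)ᗮ) :
    spectralGap M * ‖x‖ ^ 2 ≤ (⟪x, toOp M x⟫_ℂ).re := by
  set b := hM.isHermitian.eigenvectorBasis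
  rw [inner_toOp_apply_eq_sum hM.isHermitian, Complex.ofReal_re, ← b.sum_sq_norm_inner_right x,
    Finset.mul_sum]
  refine Finset.sum_le_sum fun j _ => ?_
  by_cases hj : hM.isHermitian.eigenvalues j = 0
  · have hb : b j ∈ LinearMap.ker (toOp M).toLinearMap :=
      WithLp.ofLp_injective 2 <| by simpa [hj] using hM.isHermitian.mulVec_eigenvectorBasis j
    rw [hj, hx _ hb, norm_zero, zero_pow two_ne_zero, mul_zero, zero_mul]
  · gcongr
    refine csInf_le ⟨0, fun r hr => ?_⟩
      ⟨hj, (hasEigenvalue_toLin'_ofReal_iff hM.isHermitian).2 ⟨j, rfl⟩⟩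
    obtain ⟨k, rfl⟩ := (hasEigenvalue_toLin'_ofReal_iff hM.isHermitian).1 hr.2
    exact hM.eigenvalues_nonneg k

theorem inner_toOp_hamiltonian (hH : ∀ i, IsStarProjection (H i)) (x : EuclideanSpace ℂ ι) :
    ⟪x, toOp (hamiltonian H) x⟫_ℂ = ((∑ i, ‖toOp (H i) x‖ ^ 2 : ℝ) : ℂ) := by
  rw [hamiltonian, toOp, map_sum, sum_apply, inner_sum, Complex.ofReal_sum]
  exact Finset.sum_congr rfl fun i _ => inner_self_apply_of_isStarProjection ((hH i).map _) x

theorem toOp_hamiltonian_apply_eq_zero_iff (hH : ∀ i, IsStarProjection (H i))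
    (x : EuclideanSpace ℂ ι) : toOp (hamiltonian H) x = 0 ↔ ∀ i, toOp (H i) x = 0 := by
  refine ⟨fun hx i => ?_, fun hx => ?_⟩
  · have hsum := inner_toOp_hamiltonian hH x
    rw [hx, inner_zero_right, eq_comm, Complex.ofReal_eq_zero,
      Finset.sum_eq_zero_iff_of_nonneg fun i _ => sq_nonneg _] at hsum
    simpa using hsum i (Finset.mem_univ i)
  · rw [hamiltonian, toOp, map_sum, sum_apply]
    exact Finset.sum_eq_zero fun i _ => hx i

end SpectralGap

/-! ### Contractions of the tensors in a region -/

/-- Transposing the two prescribed values at each index matches the summands. -/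
theorem sum_ite_agree_congr {ι M : Type*} [Fintype ι] [DecidableEq ι] [AddCommMonoid M]
    {π : ι → Type*} [∀ i, Fintype (π i)] [∀ i, DecidableEq (π i)] (p : ι → Prop)
    [DecidablePred p] (f : (∀ i, π i) → M) {x y : ∀ i, π i}
    (hf : ∀ z w, (∀ i, (p i → x i = y i) → z i = w i) → f z = f w) :
    (∑ z, if ∀ i, p i → z i = x i then f z else 0) =
      ∑ z, if ∀ i, p i → z i = y i then f z else 0 := by
  let e : (∀ i, π i) ≃ ∀ i, π i :=
    Equiv.piCongrRight fun i => if p i then Equiv.swap (x i) (y i) else 1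
  have e_apply (z : ∀ i, π i) (i : ι) : e z i = (if p i then Equiv.swap (x i) (y i) else 1) (z i) :=
    rfl
  rw [← e.sum_comp]
  refine Finset.sum_congr rfl fun z _ => ?_
  have agree_iff : (∀ i, p i → e z i = x i) ↔ ∀ i, p i → z i = y i := by
    refine forall₂_congr fun i hi => ?_
    rw [e_apply, if_pos hi, Equiv.swap_apply_eq_iff, Equiv.swap_apply_left]
  simp only [agree_iff]
  refine if_congr Iff.rfl (hf _ _ fun i hi => ?_) rfl
  rw [e_apply]
  split_ifs with hpi
  · rw [hi hpi, Equiv.swap_self, Equiv.refl_apply]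
  · rfl

namespace PEPS

section Contraction

variable {V : Type*} {G : SimpleGraph V}

/-- Assignments of virtual indices to all edges. -/
abbrev VirtualConf (Λ : PEPS G) : Type _ := ∀ e : G.edgeSet, Fin (Λ.bondDim e)

/-- Assignments of virtual indices to the boundary edges of a region. -/
abbrev BoundaryConf (Λ : PEPS G) (B : Finset V) : Type _ :=
  ∀ e : BoundaryEdge G B, Fin (Λ.bondDim e.1.1)

/-- The edge `e` has an end in `B`. -/
abbrev Touches (B : Finset V) (e : G.edgeSet) : Prop := ∃ v ∈ B, v ∈ e.1

/-- The product of the tensors at the vertices in `U`. -/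
def weight (Λ : PEPS G) (U : Finset V) (s : Conf Λ.physDim) (σ : Λ.VirtualConf) : ℂ :=
  ∏ v ∈ U, Λ.tensor v (s v) fun e => σ e.1

/-- The tensors that involve neither the physical indices in `U` nor the virtual indices of the
edges with both ends in `U`. They form an algebra under pointwise multiplication. -/
def exteriorTensors (Λ : PEPS G) (U : Finset V) :
    Subalgebra ℂ (Conf Λ.physDim → Λ.VirtualConf → ℂ) where
  carrier := {F | ∀ s s' σ σ', (∀ v ∉ U, s v = s' v) →
    (∀ e : G.edgeSet, (∃ v ∉ U, v ∈ e.1) → σ e = σ' e) → F s σ = F s' σ'}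
  mul_mem' hF hF' s s' σ σ' hs hσ :=
    congrArg₂ (· * ·) (hF s s' σ σ' hs hσ) (hF' s s' σ σ' hs hσ)
  add_mem' hF hF' s s' σ σ' hs hσ :=
    congrArg₂ (· + ·) (hF s s' σ σ' hs hσ) (hF' s s' σ σ' hs hσ)
  algebraMap_mem' _ _ _ _ _ _ _ := rfl

variable {Λ : PEPS G} {B U W : Finset V}

theorem exteriorTensors_anti (hUW : U ⊆ W) : Λ.exteriorTensors W ≤ Λ.exteriorTensors U :=
  fun _ hF s s' σ σ' hs hσ => hF s s' σ σ' (fun v hv => hs v fun hvU => hv (hUW hvU))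
    fun e ⟨v, hv, hve⟩ => hσ e ⟨v, fun hvU => hv (hUW hvU), hve⟩

theorem weight_mem_exteriorTensors (hWU : Disjoint W U) :
    Λ.weight W ∈ Λ.exteriorTensors U := by
  refine fun s s' σ σ' hs hσ => Finset.prod_congr rfl fun v hv => ?_
  have hvU : v ∉ U := Finset.disjoint_left.1 hWU hv
  exact congrArg₂ _ (hs v hvU) (funext fun e => hσ e.1 ⟨v, hvU, e.2⟩)

theorem weight_congr {s s' : Conf Λ.physDim} (h : ∀ v ∈ U, s v = s' v) (σ : Λ.VirtualConf) :
    Λ.weight U s σ = Λ.weight U s' σ :=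
  Finset.prod_congr rfl fun v hv => by rw [h v hv]

theorem surjective_restrict_boundary (B : Finset V) : Function.Surjective
    fun (β : Λ.VirtualConf) (e : BoundaryEdge G B) => β e.1.1 := by
  have (e : G.edgeSet) : Nonempty (Fin (Λ.bondDim e)) := Fin.pos_iff_nonempty.1 (Λ.bondDim_pos e)
  exact (Subtype.surjective_restrict _).comp (Subtype.surjective_restrict _)

variable [Fintype V] [DecidableEq V] [DecidableRel G.Adj]

/-- Contraction of the tensors at the vertices in `U` with the tensor `F`, over all virtual
indices. -/
def contract (Λ : PEPS G) (U : Finset V) :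
    (Conf Λ.physDim → Λ.VirtualConf → ℂ) →ₗ[ℂ] (Conf Λ.physDim → ℂ) where
  toFun F s := ∑ σ, F s σ * Λ.weight U s σ
  map_add' F F' := by
    funext s
    simp only [Pi.add_apply, add_mul, Finset.sum_add_distrib]
  map_smul' r F := by
    funext s
    simp only [Pi.smul_apply, smul_eq_mul, mul_assoc, Finset.mul_sum, RingHom.id_apply]

theorem contract_apply (F : Conf Λ.physDim → Λ.VirtualConf → ℂ) (s : Conf Λ.physDim) :
    Λ.contract U F s = ∑ σ, F s σ * Λ.weight U s σ :=
  rfl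

theorem contract_mul_weight (hWU : Disjoint W U) (F : Conf Λ.physDim → Λ.VirtualConf → ℂ) :
    Λ.contract U (F * Λ.weight W) = Λ.contract (W ∪ U) F := by
  funext s
  simp only [contract_apply, Pi.mul_apply, weight, Finset.prod_union hWU, mul_assoc]

/-- The vectors obtained by contracting the tensors in `U` with a tensor on the exterior of `U`. -/
def contractions (Λ : PEPS G) (U : Finset V) : Submodule ℂ (Conf Λ.physDim → ℂ) :=
  (Subalgebra.toSubmodule (Λ.exteriorTensors U)).map (Λ.contract U)

theorem contractions_anti (hUW : U ⊆ W) : Λ.contractions W ≤ Λ.contractions U := by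
  rintro _ ⟨F, hF, rfl⟩
  rw [← Finset.sdiff_union_of_subset hUW, ← contract_mul_weight Finset.sdiff_disjoint]
  exact ⟨_, mul_mem (S := Subalgebra ℂ _) (exteriorTensors_anti hUW hF)
    (weight_mem_exteriorTensors Finset.sdiff_disjoint), rfl⟩

theorem contract_univ_one : Λ.contract Finset.univ 1 = Λ.state :=
  funext fun _ => Finset.sum_congr rfl fun _ _ => one_mul _

theorem state_mem_contractions (U : Finset V) : (Λ.state : Conf Λ.physDim → ℂ) ∈
    Λ.contractions U :=
  contractions_anti (Finset.subset_univ U) ⟨1, one_mem (S := Subalgebra ℂ _) _, contract_univ_one⟩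

/-- The slices of `φ` are combinations of slices of the state, with coefficients that depend only
on the configuration outside `R i`: these coefficients enter the exterior tensor. -/
theorem mem_contractions_of_toOp_term_eq_zero {S : Type*} {R : S → Finset V} {i : S}
    {φ : StateSpace Λ.physDim} (hφ : toOp (Λ.term R i) φ = 0) :
    (φ : Conf Λ.physDim → ℂ) ∈ Λ.contractions (R i) := by
  choose k hk using fun c => (Submodule.mem_span_range_iff_exists_fun ℂ).1
    ((toOp_parentTerm_apply_eq_zero_iff Λ.state φ R i).1 hφ c)
  obtain ⟨F, hF, hFΨ⟩ := state_mem_contractions (Λ := Λ) (R i)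
  let inside (s : Conf Λ.physDim) : RegionConf Λ.physDim (R i) := fun v => s v
  let outside (s : Conf Λ.physDim) : OutsideConf Λ.physDim (R i) := fun v => s v
  refine ⟨fun s σ => ∑ c, k (outside s) c * F (glue (inside s) c) σ, ?_, ?_⟩
  · intro s s' σ σ' hs hσ
    have houtside : outside s = outside s' := funext fun v => hs v v.2
    refine Finset.sum_congr rfl fun c _ => ?_
    rw [houtside, hF _ (glue (inside s') c) σ σ' (fun v hv => ?_) hσ]
    rw [glue, glue, dif_neg hv, dif_neg hv]
  · funext s
    have hφs : φ s = ∑ c, k (outside s) c * Λ.state (glue (inside s) c) := by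
      have h := congrArg (fun x => x.ofLp (inside s)) (hk (outside s))
      simp only [WithLp.ofLp_sum, Finset.sum_apply, WithLp.ofLp_smul, Pi.smul_apply,
        smul_eq_mul] at h
      exact (congrArg φ (patch_eq_self fun _ => rfl).symm).trans h.symm
    simp only [contract_apply, hφs, ← hFΨ, Finset.sum_mul, Finset.mul_sum, mul_assoc]
    rw [Finset.sum_comm]
    refine Finset.sum_congr rfl fun c _ => Finset.sum_congr rfl fun σ _ => ?_
    rw [weight_congr fun v hv => ?_]
    exact (congrFun (restrict_glue (inside s) c) ⟨v, hv⟩).symm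

end Contraction

end PEPS

namespace PEPS

section Readout

variable {V : Type*} [Fintype V] [DecidableEq V] {G : SimpleGraph V} [DecidableRel G.Adj]
  {Λ : PEPS G} {B B' : Finset V}

/-- On the block `B` a contraction is the image under `Γ_B` of a boundary tensor, whose entries
sum up the exterior tensor at fixed virtual indices of the edges touching `B`. -/
theorem exists_regionMap_eq_contract {F : Conf Λ.physDim → Λ.VirtualConf → ℂ}
    (hF : F ∈ Λ.exteriorTensors B) (s : Conf Λ.physDim) :
    ∃ C : Λ.BoundaryConf B → ℂ,
      (Λ.regionMap B C = fun a => Λ.contract B F (patch s a)) ∧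
      ∀ β : Λ.VirtualConf, C (fun e => β e.1.1) =
        ∑ σ, if ∀ e, Touches B e → σ e = β e then F s σ else 0 := by
  let restrict (β : Λ.VirtualConf) : Λ.BoundaryConf B := fun e => β e.1.1
  let sumTouching (β : Λ.VirtualConf) : ℂ :=
    ∑ σ, if ∀ e, Touches B e → σ e = β e then F s σ else 0
  have hfactors : sumTouching.FactorsThrough restrict := by
    intro β β' hβ
    refine sum_ite_agree_congr _ (F s) fun σ σ' hσ => hF s s σ σ' (fun _ _ => rfl) ?_
    exact fun e he => hσ e fun ht => congrFun hβ ⟨⟨e, ht⟩, he⟩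
  have extend_restrict (β : Λ.VirtualConf) :
      Function.extend restrict sumTouching 0 (restrict β) = sumTouching β :=
    hfactors.extend_apply 0 β
  refine ⟨Function.extend restrict sumTouching 0, funext fun a => ?_, extend_restrict⟩
  let touching (σ : Λ.VirtualConf) (e : TouchingEdge G B) : Fin (Λ.bondDim e.1) := σ e.1
  have hbond (e : G.edgeSet) : Nonempty (Fin (Λ.bondDim e)) :=
    Fin.pos_iff_nonempty.1 (Λ.bondDim_pos e)
  rw [contract_apply, ← Finset.sum_fiberwise _ touching, regionMap]
  refine Finset.sum_congr rfl fun τ _ => ?_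
  obtain ⟨β, rfl⟩ : ∃ β, touching β = τ :=
    Subtype.surjective_restrict (β := fun e => Fin (Λ.bondDim e)) (Touches B) τ
  rw [show (fun e : BoundaryEdge G B => touching β e.1) = restrict β from rfl, extend_restrict,
    Finset.sum_mul, Finset.sum_filter]
  refine Finset.sum_congr rfl fun σ _ => ?_
  rw [ite_mul, zero_mul]
  have agree_iff : (∀ e, Touches B e → σ e = β e) ↔ touching σ = touching β :=
    ⟨fun h => funext fun e => h e.1 e.2, fun h e he => congrFun h ⟨e, he⟩⟩
  refine if_ctx_congr agree_iff (fun hσ => ?_) fun _ => rfl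
  rw [hF (patch s a) s σ σ (fun v hv => patch_of_notMem s a hv) fun _ _ => rfl, weight,
    ← Finset.prod_coe_sort B]
  refine congrArg _ (Fintype.prod_congr _ _ fun v => ?_)
  rw [patch_of_mem s a v.2]
  exact congrArg _ (funext fun e => (congrFun hσ ⟨e.1, v, v.2, e.2⟩).symm)

/-- `Γ_B` as a linear map. -/
def regionMapLinear (Λ : PEPS G) (B : Finset V) :
    (Λ.BoundaryConf B → ℂ) →ₗ[ℂ] (RegionConf Λ.physDim B → ℂ) where
  toFun := Λ.regionMap B
  map_add' C C' := by
    funext a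
    simp only [regionMap, Pi.add_apply, add_mul, Finset.sum_add_distrib]
  map_smul' r C := by
    funext a
    simp only [regionMap, Pi.smul_apply, smul_eq_mul, mul_assoc, Finset.mul_sum, RingHom.id_apply]

/-- The entry at `β` of a left inverse of `Γ_B`: it reads the boundary indices `β` out of a vector
on an injective block `B`. -/
noncomputable def readout (Λ : PEPS G) (B : Finset V) (β : Λ.VirtualConf) :
    Module.Dual ℂ (RegionConf Λ.physDim B → ℂ) :=
  LinearMap.proj (fun e : BoundaryEdge G B => β e.1.1) ∘ₗ (Λ.regionMapLinear B).leftInverse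

theorem readout_regionMap (hB : Λ.InjectiveRegion B) (C : Λ.BoundaryConf B → ℂ)
    (β : Λ.VirtualConf) : Λ.readout B β (Λ.regionMap B C) = C fun e => β e.1.1 :=
  congrFun (LinearMap.leftInverse_apply_of_inj (LinearMap.ker_eq_bot.2 hB :
    LinearMap.ker (Λ.regionMapLinear B) = ⊥) C) _

/-- `readout`, applied to the block `B` of a vector on the whole system. -/
noncomputable def readOp (Λ : PEPS G) (B : Finset V) (β : Λ.VirtualConf) :
    Module.End ℂ (Conf Λ.physDim → ℂ) where
  toFun φ s := Λ.readout B β fun a => φ (patch s a)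
  map_add' _ _ := funext fun _ => map_add (Λ.readout B β) _ _
  map_smul' r _ := funext fun _ => map_smul (Λ.readout B β) r _

theorem readOp_apply (β : Λ.VirtualConf) (φ : Conf Λ.physDim → ℂ) (s : Conf Λ.physDim) :
    Λ.readOp B β φ s = Λ.readout B β fun a => φ (patch s a) :=
  rfl

theorem readOp_congr {β β' : Λ.VirtualConf} (h : ∀ e, Touches B e → β e = β' e) :
    Λ.readOp B β = Λ.readOp B β' := by
  have hrestrict : (fun e : BoundaryEdge G B => β e.1.1) = fun e : BoundaryEdge G B => β' e.1.1 :=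
    funext fun e => h _ e.1.2
  refine LinearMap.ext fun φ => funext fun s => ?_
  rw [readOp_apply, readOp_apply, readout, readout, hrestrict]

theorem readOp_apply_congr (β : Λ.VirtualConf) (φ : Conf Λ.physDim → ℂ) {s s' : Conf Λ.physDim}
    (h : ∀ v ∉ B, s v = s' v) : Λ.readOp B β φ s = Λ.readOp B β φ s' := by
  have hpatch (a : RegionConf Λ.physDim B) : patch s a = patch s' a :=
    funext fun v => patch_apply_congr a (h v)
  simp only [readOp_apply, hpatch]

theorem commute_readOp (hB : Disjoint B B') (β β' : Λ.VirtualConf) :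
    Commute (Λ.readOp B β) (Λ.readOp B' β') := by
  refine LinearMap.ext fun φ => funext fun s => ?_
  obtain ⟨D, hD⟩ : ∃ D : RegionConf Λ.physDim B → ℂ, ∀ x, Λ.readout B β x = ∑ a, x a * D a :=
    ⟨_, LinearMap.pi_apply_eq_sum_univ _⟩
  obtain ⟨D', hD'⟩ : ∃ D : RegionConf Λ.physDim B' → ℂ, ∀ x, Λ.readout B' β' x = ∑ a, x a * D a :=
    ⟨_, LinearMap.pi_apply_eq_sum_univ _⟩
  simp only [Module.End.mul_apply, readOp_apply, hD, hD', Finset.sum_mul]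
  rw [Finset.sum_comm]
  refine Finset.sum_congr rfl fun a' _ => Finset.sum_congr rfl fun a _ => ?_
  rw [patch_comm hB, mul_right_comm]

theorem readOp_contract (hB : Λ.InjectiveRegion B) (β : Λ.VirtualConf)
    {F : Conf Λ.physDim → Λ.VirtualConf → ℂ} (hF : F ∈ Λ.exteriorTensors B)
    (s : Conf Λ.physDim) : Λ.readOp B β (Λ.contract B F) s =
      ∑ σ, if ∀ e, Touches B e → σ e = β e then F s σ else 0 := by
  obtain ⟨C, hCF, hC⟩ := exists_regionMap_eq_contract hF s
  rw [readOp_apply, ← hCF, readout_regionMap hB, hC]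

theorem eq_zero_of_readOp_eq_zero (hB : Λ.InjectiveRegion B) {φ : Conf Λ.physDim → ℂ}
    (hφ : φ ∈ Λ.contractions B) (h0 : ∀ β, Λ.readOp B β φ = 0) : φ = 0 := by
  obtain ⟨F, hF, rfl⟩ := hφ
  funext s
  obtain ⟨C, hCF, -⟩ := exists_regionMap_eq_contract hF s
  have hC : C = 0 := by
    funext ρ
    obtain ⟨β, rfl⟩ := surjective_restrict_boundary B ρ
    refine (readout_regionMap hB C β).symm.trans ?_
    rw [hCF, ← readOp_apply, h0]
    rfl
  rw [← patch_eq_self (s := s) (a := fun v : {v // v ∈ B} => s v) fun _ => rfl,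
    ← congrFun hCF, hC]
  exact congrFun (map_zero (Λ.regionMapLinear B)) _

theorem readOp_mem_contractions (hB : Disjoint B B') (β : Λ.VirtualConf)
    {φ : Conf Λ.physDim → ℂ} (hφ : φ ∈ Λ.contractions B') :
    Λ.readOp B β φ ∈ Λ.contractions B' := by
  obtain ⟨F, hF, rfl⟩ := hφ
  refine ⟨fun s σ => Λ.readOp B β (fun t => F t σ) s, fun s s' σ σ' hs hσ => ?_, ?_⟩
  · exact congrArg (Λ.readout B β) (funext fun a =>
      hF _ _ σ σ' (fun v hv => patch_apply_congr a fun _ => hs v hv) hσ)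
  · funext s
    have hsum : (fun a => Λ.contract B' F (patch s a)) =
        ∑ σ, Λ.weight B' s σ • fun a : RegionConf Λ.physDim B => F (patch s a) σ := by
      funext a
      rw [contract_apply, Finset.sum_apply]
      refine Finset.sum_congr rfl fun σ _ => ?_
      rw [weight_congr fun v hv => patch_of_notMem s a (Finset.disjoint_right.1 hB hv)]
      exact mul_comm _ _
    rw [readOp_apply, hsum, map_sum, contract_apply]
    refine Finset.sum_congr rfl fun σ _ => ?_
    rw [map_smul, readOp_apply, smul_eq_mul, mul_comm]

end Readout

end PEPS

theorem eq_of_forall_update_eq {ι X : Type*} [Finite ι] [DecidableEq ι] {π : ι → Type*}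
    (f : (∀ i, π i) → X) (hf : ∀ s i x, f (Function.update s i x) = f s) (s s' : ∀ i, π i) :
    f s = f s' := by
  cases nonempty_fintype ι
  have key (T : Finset ι) : f (T.piecewise s' s) = f s := by
    induction T using Finset.induction_on with
    | empty => rw [Finset.piecewise_empty]
    | insert j T _ ih => rw [Finset.piecewise_insert, hf, ih]
  rw [← key Finset.univ, Finset.piecewise_univ]

namespace PEPS

section Blocks

variable {V : Type*} [Fintype V] [DecidableEq V] {G : SimpleGraph V}
  {P : Finpartition (Finset.univ : Finset V)}

theorem exists_mem_parts_touches (P : Finpartition (Finset.univ : Finset V)) (e : G.edgeSet) :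
    ∃ B ∈ P.parts, Touches B e := by
  obtain ⟨B, hB, hvB⟩ := P.exists_mem (Finset.mem_univ (Quot.out e.1).1)
  exact ⟨B, hB, _, hvB, Sym2.out_fst_mem e.1⟩

/-- The blocks of the partition `P` that contain an end of the edge `e`. -/
def blocksAt (P : Finpartition (Finset.univ : Finset V)) (e : G.edgeSet) : Finset (Finset V) :=
  P.parts.filter fun B => Touches B e

theorem blocksAt_subset (e : G.edgeSet) : blocksAt P e ⊆ P.parts :=
  Finset.filter_subset _ _

theorem mem_blocksAt {e : G.edgeSet} {B : Finset V} :
    B ∈ blocksAt P e ↔ B ∈ P.parts ∧ Touches B e :=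
  Finset.mem_filter

theorem mem_biUnion_blocksAt {e : G.edgeSet} {v : V} (hv : v ∈ e.1) :
    v ∈ (blocksAt P e).biUnion id := by
  obtain ⟨B, hB, hvB⟩ := P.exists_mem (Finset.mem_univ v)
  exact Finset.mem_biUnion.2 ⟨B, mem_blocksAt.2 ⟨hB, v, hvB, hv⟩, hvB⟩

theorem pairwiseDisjoint_blocksAt (P : Finpartition (Finset.univ : Finset V)) (e : G.edgeSet) :
    (blocksAt P e : Set (Finset V)).PairwiseDisjoint id :=
  P.disjoint.subset (Finset.coe_subset.2 (blocksAt_subset e))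

theorem exists_blockAdj (hG : G.Connected) (hP : 2 ≤ P.parts.card) {B : Finset V}
    (hB : B ∈ P.parts) : ∃ B' ∈ P.parts, BlockAdj G B B' := by
  obtain ⟨B₁, hB₁, hne⟩ := Finset.exists_mem_ne hP B
  obtain ⟨v, hv⟩ := P.nonempty_of_mem_parts hB
  obtain ⟨w, hw⟩ := P.nonempty_of_mem_parts hB₁
  have hwB : w ∉ B := fun h => hne (P.eq_of_mem_parts hB₁ hB hw h)
  obtain ⟨p⟩ := hG.preconnected v w
  obtain ⟨d, -, hfst, hsnd⟩ := p.exists_boundary_dart (B : Set V) hv hwB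
  obtain ⟨B', hB', hd⟩ := P.exists_mem (Finset.mem_univ d.snd)
  exact ⟨B', hB', fun h => hsnd (h ▸ hd), d.fst, hfst, d.snd, hd, d.adj⟩

theorem exists_subset_of_mem_parts {S : Type*} {R : S → Finset V} (hG : G.Connected)
    (hP : 2 ≤ P.parts.card) (hR : RangesCover G R P) {B : Finset V} (hB : B ∈ P.parts) :
    ∃ i, B ⊆ R i := by
  obtain ⟨B', hB', hadj⟩ := exists_blockAdj hG hP hB
  obtain ⟨i, hi, -⟩ := hR B hB B' hB' hadj
  exact ⟨i, hi⟩

theorem exists_biUnion_blocksAt_subset {S : Type*} {R : S → Finset V} (hG : G.Connected)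
    (hP : 2 ≤ P.parts.card) (hR : RangesCover G R P) (e : G.edgeSet) :
    ∃ i, (blocksAt P e).biUnion id ⊆ R i := by
  obtain ⟨⟨v, w⟩, hvw⟩ := e
  obtain ⟨B, hB, hvB⟩ := P.exists_mem (Finset.mem_univ v)
  obtain ⟨B', hB', hwB'⟩ := P.exists_mem (Finset.mem_univ w)
  obtain ⟨i, hi, hi'⟩ : ∃ i, B ⊆ R i ∧ B' ⊆ R i := by
    by_cases hBB : B = B'
    · obtain ⟨i, hi⟩ := exists_subset_of_mem_parts hG hP hR hB
      exact ⟨i, hi, hBB ▸ hi⟩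
    · exact hR B hB B' hB' ⟨hBB, v, hvB, w, hwB', hvw⟩
  refine ⟨i, Finset.biUnion_subset.2 fun B₁ hB₁ => ?_⟩
  obtain ⟨hB₁P, u, huB₁, hu⟩ := mem_blocksAt.1 hB₁
  obtain rfl | rfl := Sym2.mem_iff.1 hu
  · rwa [P.eq_of_mem_parts hB₁P hB huB₁ hvB]
  · rwa [P.eq_of_mem_parts hB₁P hB' huB₁ hwB']

end Blocks

section ReadAll

variable {V : Type*} [Fintype V] [DecidableEq V] {G : SimpleGraph V} [DecidableRel G.Adj]
  {Λ : PEPS G} {T : Finset (Finset V)}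

theorem pairwise_commute_readOp (hT : (T : Set (Finset V)).PairwiseDisjoint id)
    (β : Finset V → Λ.VirtualConf) :
    (T : Set (Finset V)).Pairwise (Function.onFun Commute fun B => Λ.readOp B (β B)) :=
  fun _ hB _ hB' hne => commute_readOp (hT hB hB' hne) _ _

/-- Read out the boundary indices `β B` of all the disjoint blocks `B ∈ T`. -/
noncomputable def readAll (Λ : PEPS G) (T : Finset (Finset V))
    (hT : (T : Set (Finset V)).PairwiseDisjoint id) (β : Finset V → Λ.VirtualConf) :
    Module.End ℂ (Conf Λ.physDim → ℂ) :=
  T.noncommProd (fun B => Λ.readOp B (β B)) (pairwise_commute_readOp hT β)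

theorem readAll_congr (hT : (T : Set (Finset V)).PairwiseDisjoint id)
    {β β' : Finset V → Λ.VirtualConf} (h : ∀ B ∈ T, ∀ e, Touches B e → β B e = β' B e) :
    Λ.readAll T hT β = Λ.readAll T hT β' :=
  Finset.noncommProd_congr rfl (fun B hB => readOp_congr (h B hB)) _

theorem readAll_insert {B : Finset V} (hBT : B ∉ T)
    (hT : ((insert B T : Finset (Finset V)) : Set (Finset V)).PairwiseDisjoint id)
    (β : Finset V → Λ.VirtualConf) : Λ.readAll (insert B T) hT β =
      Λ.readOp B (β B) *
        Λ.readAll T (hT.subset (Finset.coe_subset.2 (Finset.subset_insert B T))) β :=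
  Finset.noncommProd_insert_of_notMem _ _ _ _ hBT

theorem readAll_insert' {B : Finset V} (hBT : B ∉ T)
    (hT : ((insert B T : Finset (Finset V)) : Set (Finset V)).PairwiseDisjoint id)
    (β : Finset V → Λ.VirtualConf) : Λ.readAll (insert B T) hT β =
      Λ.readAll T (hT.subset (Finset.coe_subset.2 (Finset.subset_insert B T))) β *
        Λ.readOp B (β B) :=
  Finset.noncommProd_insert_of_notMem' _ _ _ _ hBT

theorem readAll_sdiff_mul {T' : Finset (Finset V)} (hTT' : T' ⊆ T)
    (hT : (T : Set (Finset V)).PairwiseDisjoint id) (β : Finset V → Λ.VirtualConf) :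
    Λ.readAll (T \ T') (hT.subset (Finset.coe_subset.2 Finset.sdiff_subset)) β *
      Λ.readAll T' (hT.subset (Finset.coe_subset.2 hTT')) β = Λ.readAll T hT β := by
  unfold readAll
  rw [← Finset.noncommProd_union_of_disjoint Finset.sdiff_disjoint]
  · exact Finset.noncommProd_congr (Finset.sdiff_union_of_subset hTT') (fun _ _ => rfl) _
  · rw [Finset.sdiff_union_of_subset hTT']
    exact pairwise_commute_readOp hT β

theorem readAll_apply_congr (hT : (T : Set (Finset V)).PairwiseDisjoint id)
    (β : Finset V → Λ.VirtualConf) (φ : Conf Λ.physDim → ℂ) {B : Finset V} (hB : B ∈ T)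
    {s s' : Conf Λ.physDim} (h : ∀ v ∉ B, s v = s' v) :
    Λ.readAll T hT β φ s = Λ.readAll T hT β φ s' := by
  rw [readAll, ← Finset.mul_noncommProd_erase T hB]
  exact readOp_apply_congr _ _ h

theorem readAll_contract (hT : (T : Set (Finset V)).PairwiseDisjoint id)
    (hinj : ∀ B ∈ T, Λ.InjectiveRegion B) (β : Finset V → Λ.VirtualConf)
    {F : Conf Λ.physDim → Λ.VirtualConf → ℂ} (hF : F ∈ Λ.exteriorTensors (T.biUnion id))
    (s : Conf Λ.physDim) : Λ.readAll T hT β (Λ.contract (T.biUnion id) F) s =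
      ∑ σ, if ∀ B ∈ T, ∀ e, Touches B e → σ e = β B e then F s σ else 0 := by
  induction T using Finset.induction_on generalizing F s with
  | empty => simp [readAll, contract_apply, weight]
  | insert B T hBT ih =>
    rw [Finset.biUnion_insert, id] at hF ⊢
    have hdisj : ∀ B' ∈ T, Disjoint B B' := fun B' hB' =>
      hT (Finset.mem_insert_self _ _) (Finset.mem_insert_of_mem hB')
        fun h => hBT (h ▸ hB')
    have hBU : Disjoint B (T.biUnion id) := (Finset.disjoint_biUnion_right _ _ _).2 hdisj
    let Fread : Conf Λ.physDim → Λ.VirtualConf → ℂ := fun s σ =>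
      if ∀ B ∈ T, ∀ e, Touches B e → σ e = β B e then F s σ else 0
    have hFread : Fread ∈ Λ.exteriorTensors B := by
      intro s s' σ σ' hs hσ
      have agree_iff : (∀ B ∈ T, ∀ e, Touches B e → σ e = β B e) ↔
          ∀ B ∈ T, ∀ e, Touches B e → σ' e = β B e :=
        forall₂_congr fun B' hB' => forall_congr' fun e => imp_congr_right fun ⟨v, hv, hve⟩ => by
          rw [hσ e ⟨v, Finset.disjoint_right.1 (hdisj B' hB') hv, hve⟩]
      exact if_congr agree_iff
        (exteriorTensors_anti Finset.subset_union_left hF s s' σ σ' hs hσ) rfl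
    have hread : Λ.readAll T (hT.subset (Finset.coe_subset.2 (Finset.subset_insert B T))) β
        (Λ.contract (B ∪ T.biUnion id) F) = Λ.contract B Fread := by
      funext t
      rw [← contract_mul_weight hBU]
      refine (ih _ (fun B' hB' => hinj B' (Finset.mem_insert_of_mem hB'))
        (mul_mem (exteriorTensors_anti Finset.subset_union_right hF)
          (weight_mem_exteriorTensors hBU)) t).trans (Finset.sum_congr rfl fun σ _ => ?_)
      exact (ite_zero_mul _ _ _).symm
    rw [readAll_insert hBT, Module.End.mul_apply, hread,
      readOp_contract (hinj B (Finset.mem_insert_self _ _)) (β B) hFread]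
    simp only [Fread, Finset.forall_mem_insert, ite_and]

theorem eq_zero_of_readAll_eq_zero (hT : (T : Set (Finset V)).PairwiseDisjoint id)
    (hinj : ∀ B ∈ T, Λ.InjectiveRegion B) {φ : Conf Λ.physDim → ℂ}
    (hφ : ∀ B ∈ T, φ ∈ Λ.contractions B) (h0 : ∀ β, Λ.readAll T hT β φ = 0) : φ = 0 := by
  induction T using Finset.induction_on generalizing φ with
  | empty => exact h0 fun _ e => ⟨0, Λ.bondDim_pos e⟩
  | insert B T hBT ih =>
    have hne : ∀ B' ∈ T, B' ≠ B := fun B' hB' h => hBT (h ▸ hB')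
    refine eq_zero_of_readOp_eq_zero (hinj B (Finset.mem_insert_self _ _))
      (hφ B (Finset.mem_insert_self _ _)) fun γ => ?_
    refine ih (hT.subset (Finset.coe_subset.2 (Finset.subset_insert B T)))
      (fun B' hB' => hinj B' (Finset.mem_insert_of_mem hB')) (fun B' hB' => ?_) fun β => ?_
    · exact readOp_mem_contractions
        (hT (Finset.mem_insert_self _ _) (Finset.mem_insert_of_mem hB') (hne B' hB').symm) γ
        (hφ B' (Finset.mem_insert_of_mem hB'))
    · rw [← h0 (Function.update β B γ), readAll_insert' hBT, Module.End.mul_apply,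
        Function.update_self]
      refine congrFun (congrArg DFunLike.coe (readAll_congr _ fun B' hB' e _ => ?_)) _
      rw [Function.update_of_ne (hne B' hB')]

variable {P : Finpartition (Finset.univ : Finset V)}

theorem readAll_apply_eq (β : Finset V → Λ.VirtualConf) (φ : Conf Λ.physDim → ℂ)
    (s s' : Conf Λ.physDim) :
    Λ.readAll P.parts P.disjoint β φ s = Λ.readAll P.parts P.disjoint β φ s' := by
  refine eq_of_forall_update_eq _ (fun s v x => ?_) s s'
  obtain ⟨B, hB, hvB⟩ := P.exists_mem (Finset.mem_univ v)
  exact readAll_apply_congr _ β φ hB fun w hw =>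
    Function.update_of_ne (ne_of_mem_of_not_mem hvB hw).symm x s

theorem readAll_state (hinj : ∀ B ∈ P.parts, Λ.InjectiveRegion B) (σ₀ : Λ.VirtualConf)
    (s : Conf Λ.physDim) : Λ.readAll P.parts P.disjoint (fun _ => σ₀) Λ.state s = 1 := by
  have hstate : Λ.contract (P.parts.biUnion id) 1 = Λ.state := by
    rw [P.biUnion_parts, contract_univ_one]
  rw [← hstate, readAll_contract P.disjoint hinj _ (one_mem _),
    Fintype.sum_eq_single σ₀, if_pos fun _ _ _ _ => rfl]
  · rfl
  · refine fun σ hσ => if_neg fun h => hσ (funext fun e => ?_)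
    obtain ⟨B, hB, he⟩ := exists_mem_parts_touches P e
    exact h B hB e he

/-! ### Uniqueness of the ground state -/

theorem readAll_eq_zero_of_ne (hinj : ∀ B ∈ P.parts, Λ.InjectiveRegion B) {φ : Conf Λ.physDim → ℂ}
    {e : G.edgeSet} (hφ : φ ∈ Λ.contractions ((blocksAt P e).biUnion id))
    {β : Finset V → Λ.VirtualConf} {B B' : Finset V} (hB : B ∈ blocksAt P e)
    (hB' : B' ∈ blocksAt P e) (hne : β B e ≠ β B' e) :
    Λ.readAll P.parts P.disjoint β φ = 0 := by
  obtain ⟨F, hF, rfl⟩ := hφ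
  have hzero : Λ.readAll (blocksAt P e) (pairwiseDisjoint_blocksAt P e) β
      (Λ.contract ((blocksAt P e).biUnion id) F) = 0 := by
    funext s
    rw [readAll_contract _ (fun B hB => hinj B (blocksAt_subset e hB)) _ hF]
    refine Finset.sum_eq_zero fun σ _ => if_neg fun h => hne ?_
    rw [← h B hB e (mem_blocksAt.1 hB).2, h B' hB' e (mem_blocksAt.1 hB').2]
  rw [← readAll_sdiff_mul (blocksAt_subset e) P.disjoint, Module.End.mul_apply, hzero, map_zero]

/-- The exterior tensor of the blocks around `e` does not involve the index on `e`. -/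
theorem readAll_update (hinj : ∀ B ∈ P.parts, Λ.InjectiveRegion B) {φ : Conf Λ.physDim → ℂ}
    {e : G.edgeSet} (hφ : φ ∈ Λ.contractions ((blocksAt P e).biUnion id)) (σ₀ : Λ.VirtualConf)
    (x : Fin (Λ.bondDim e)) :
    Λ.readAll P.parts P.disjoint (fun _ => Function.update σ₀ e x) φ =
      Λ.readAll P.parts P.disjoint (fun _ => σ₀) φ := by
  obtain ⟨F, hF, rfl⟩ := hφ
  have hinner : Λ.readAll (blocksAt P e) (pairwiseDisjoint_blocksAt P e)
        (fun _ => Function.update σ₀ e x) (Λ.contract ((blocksAt P e).biUnion id) F) =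
      Λ.readAll (blocksAt P e) (pairwiseDisjoint_blocksAt P e) (fun _ => σ₀)
        (Λ.contract ((blocksAt P e).biUnion id) F) := by
    funext s
    have hinj_e : ∀ B ∈ blocksAt P e, Λ.InjectiveRegion B :=
      fun B hB => hinj B (blocksAt_subset e hB)
    have swap_forall (σ β : Λ.VirtualConf) :
        (∀ B ∈ blocksAt P e, ∀ e', Touches B e' → σ e' = β e') ↔
          ∀ e', (∃ B ∈ blocksAt P e, Touches B e') → σ e' = β e' :=
      ⟨fun h e' ⟨B, hB, he'⟩ => h B hB e' he', fun h B hB e' he' => h e' ⟨B, hB, he'⟩⟩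
    rw [readAll_contract _ hinj_e _ hF, readAll_contract _ hinj_e _ hF]
    simp only [swap_forall]
    refine sum_ite_agree_congr _ (F s) fun σ σ' hσ =>
      hF s s σ σ' (fun _ _ => rfl) fun e' ⟨v, hv, hve'⟩ => hσ e' fun _ => ?_
    have hne : e' ≠ e := by
      rintro rfl
      exact hv (mem_biUnion_blocksAt hve')
    exact Function.update_of_ne hne _ _
  rw [← readAll_sdiff_mul (blocksAt_subset e) P.disjoint, Module.End.mul_apply, hinner,
    ← readAll_sdiff_mul (blocksAt_subset e) P.disjoint, Module.End.mul_apply]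
  refine congrFun (congrArg DFunLike.coe (readAll_congr _ fun B hB e' he' => ?_)) _
  refine Function.update_of_ne (fun h => (Finset.mem_sdiff.1 hB).2 ?_) _ _
  exact mem_blocksAt.2 ⟨(Finset.mem_sdiff.1 hB).1, h ▸ he'⟩

theorem eq_zero_of_mem_contractions_blocksAt (hinj : ∀ B ∈ P.parts, Λ.InjectiveRegion B)
    {φ : Conf Λ.physDim → ℂ} (hblock : ∀ B ∈ P.parts, φ ∈ Λ.contractions B)
    (hedge : ∀ e : G.edgeSet, φ ∈ Λ.contractions ((blocksAt P e).biUnion id))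
    {σ₀ : Λ.VirtualConf} {s₀ : Conf Λ.physDim}
    (h0 : Λ.readAll P.parts P.disjoint (fun _ => σ₀) φ s₀ = 0) : φ = 0 := by
  have hconst (σ : Λ.VirtualConf) : Λ.readAll P.parts P.disjoint (fun _ => σ) φ = 0 := by
    funext s
    rw [readAll_apply_eq _ _ s s₀, eq_of_forall_update_eq
      (fun σ : Λ.VirtualConf => Λ.readAll P.parts P.disjoint (fun _ => σ) φ)
      (fun σ e x => readAll_update hinj (hedge e) σ x) σ σ₀, h0]
    rfl
  refine eq_zero_of_readAll_eq_zero P.disjoint hinj hblock fun β => ?_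
  by_cases hβ : ∃ e : G.edgeSet, ∃ B ∈ blocksAt P e, ∃ B' ∈ blocksAt P e, β B e ≠ β B' e
  · obtain ⟨e, B, hB, B', hB', hne⟩ := hβ
    exact readAll_eq_zero_of_ne hinj (hedge e) hB hB' hne
  · push Not at hβ
    choose b hb hbe using fun e : G.edgeSet => exists_mem_parts_touches P e
    rw [← hconst fun e => β (b e) e]
    refine congrFun (congrArg DFunLike.coe (readAll_congr _ fun B hB e he => ?_)) _
    exact hβ e B (mem_blocksAt.2 ⟨hB, he⟩) (b e) (mem_blocksAt.2 ⟨hb e, hbe e⟩)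

theorem nonempty_conf (hinj : ∀ B ∈ P.parts, Λ.InjectiveRegion B) :
    Nonempty (Conf Λ.physDim) := by
  refine Classical.nonempty_pi.2 fun v => ?_
  by_contra hv
  rw [not_nonempty_iff] at hv
  obtain ⟨B, hB, hvB⟩ := P.exists_mem (Finset.mem_univ v)
  have zero_eq_one : (fun _ => 0 : Λ.BoundaryConf B → ℂ) = fun _ => 1 :=
    hinj B hB (funext fun a => hv.elim (a ⟨v, hvB⟩))
  exact zero_ne_one (congrFun zero_eq_one fun e => ⟨0, Λ.bondDim_pos _⟩)

theorem state_ne_zero (hinj : ∀ B ∈ P.parts, Λ.InjectiveRegion B) : Λ.state ≠ 0 := by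
  intro h
  obtain ⟨s⟩ := nonempty_conf hinj
  have hone := readAll_state hinj (fun e => ⟨0, Λ.bondDim_pos e⟩) s
  rw [h, WithLp.ofLp_zero, map_zero] at hone
  exact zero_ne_one hone

theorem ker_hamiltonian_eq_span (hG : G.Connected) (hP : Λ.IsInjectiveCovering P) {S : Type*}
    [Fintype S] {R : S → Finset V} (hR : RangesCover G R P) :
    LinearMap.ker (toOp (hamiltonian (Λ.term R))).toLinearMap = Submodule.span ℂ {Λ.state} := by
  have hproj := isStarProjection_parentTerm Λ.state R
  refine le_antisymm (fun φ hφ => ?_) ?_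
  · have hterm (i : S) : toOp (Λ.term R i) φ = 0 :=
      (toOp_hamiltonian_apply_eq_zero_iff hproj φ).1 hφ i
    obtain ⟨s₀⟩ := nonempty_conf hP.2
    let σ₀ : Λ.VirtualConf := fun e => ⟨0, Λ.bondDim_pos e⟩
    let r : ℂ := Λ.readAll P.parts P.disjoint (fun _ => σ₀) φ s₀
    have hmem {U : Finset V} : (∃ i, U ⊆ R i) → φ.ofLp - r • Λ.state.ofLp ∈ Λ.contractions U :=
      fun ⟨i, hi⟩ => sub_mem
        (contractions_anti hi (mem_contractions_of_toOp_term_eq_zero (hterm i)))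
        (Submodule.smul_mem _ r (state_mem_contractions U))
    have hzero : φ.ofLp - r • Λ.state.ofLp = 0 := by
      refine eq_zero_of_mem_contractions_blocksAt hP.2
        (fun B hB => hmem (exists_subset_of_mem_parts hG hP.1 hR hB))
        (fun e => hmem (exists_biUnion_blocksAt_subset hG hP.1 hR e)) (σ₀ := σ₀) (s₀ := s₀) ?_
      rw [map_sub, map_smul, Pi.sub_apply, Pi.smul_apply, readAll_state hP.2, smul_eq_mul,
        mul_one, sub_self]
    exact Submodule.mem_span_singleton.2
      ⟨r, WithLp.ofLp_injective 2 (sub_eq_zero.1 hzero).symm⟩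
  · rw [Submodule.span_singleton_le_iff_mem]
    exact (toOp_hamiltonian_apply_eq_zero_iff hproj _).2 (toOp_parentTerm_apply_self Λ.state R)

end ReadAll

end PEPS

/-! ### Correlations and the gap -/

section Correlation

variable {ι S : Type*} [Fintype ι] {H : S → Matrix ι ι ℂ}

theorem opDist_le_edist {O O' : Matrix ι ι ℂ} {i j : S} (hi : ¬ Commute O (H i))
    (hj : ¬ Commute O' (H j)) : opDist H O O' ≤ (interactionGraph H).edist i j :=
  iInf₂_le_of_le i j (iInf₂_le hi hj)

variable [DecidableEq ι]

theorem commute_toOp_iff {M N : Matrix ι ι ℂ} : Commute (toOp M) (toOp N) ↔ Commute M N :=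
  commute_map_iff (Matrix.toEuclideanCLM (n := ι) (𝕜 := ℂ)).injective

variable [Fintype S]

theorem norm_correlation_toOp_le (hH : ∀ i, IsStarProjection (H i)) {ψ : EuclideanSpace ℂ ι}
    (hψ : ‖ψ‖ = 1) (hker : LinearMap.ker (toOp (hamiltonian H)).toLinearMap = ℂ ∙ ψ) {g : ℕ}
    (hg : ∀ i, ((interactionGraph H).neighborSet i).ncard ≤ g) {O O' : Matrix ι ι ℂ} {m : ℕ}
    (hfar : ((2 * (g + 1) * m : ℕ) : ℕ∞) < opDist H O O') {η : ℝ}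
    (hη : ((g : ℝ) + 1) ^ 2 * Real.sinh η ^ 2 ≤ spectralGap (hamiltonian H)) :
    ‖⟪ψ, toOp O (toOp O' ψ)⟫_ℂ - ⟪ψ, toOp O ψ⟫_ℂ * ⟪ψ, toOp O' ψ⟫_ℂ‖ ≤
      (Real.cosh (m * (2 * η)))⁻¹ * (‖star (toOp O) ψ‖ * ‖toOp O' ψ‖) := by
  classical
  have hground (i : S) : toOp (H i) ψ = 0 := by
    refine (toOp_hamiltonian_apply_eq_zero_iff hH ψ).1 ?_ i
    rw [← ContinuousLinearMap.coe_coe, ← LinearMap.mem_ker, hker]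
    exact Submodule.mem_span_singleton_self ψ
  have hdegree (i : S) : (interactionGraph H).degree i ≤ g := by
    rw [← SimpleGraph.card_neighborSet_eq_degree, ← Set.toFinset_card,
      ← Set.ncard_eq_toFinset_card']
    exact hg i
  have hgap (x : EuclideanSpace ℂ ι) (hx : x ∈ (ℂ ∙ ψ)ᗮ) :
      spectralGap (hamiltonian H) * ‖x‖ ^ 2 ≤ ∑ i, ‖toOp (H i) x‖ ^ 2 := by
    rw [← Complex.ofReal_re (∑ i, _), ← inner_toOp_hamiltonian hH]
    exact spectralGap_mul_norm_sq_le (posSemidef_hamiltonian hH) (hker ▸ hx)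
  exact norm_correlation_le (fun i => (hH i).map _) hψ hground
    (fun i j hij => commute_toOp_iff.2 (not_not.1 hij)) hdegree hgap
    (fun i j hi hj => hfar.trans_le <|
      opDist_le_edist (commute_toOp_iff.not.1 hi) (commute_toOp_iff.not.1 hj)) hη

theorem connectedCorrelation_le (hH : ∀ i, IsStarProjection (H i)) {ψ : EuclideanSpace ℂ ι}
    (hψ : ψ ≠ 0) (hker : LinearMap.ker (toOp (hamiltonian H)).toLinearMap = ℂ ∙ ψ) {g : ℕ}
    (hg : ∀ i, ((interactionGraph H).neighborSet i).ncard ≤ g) {O O' : Matrix ι ι ℂ} {m : ℕ}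
    (hfar : ((2 * (g + 1) * m : ℕ) : ℕ∞) < opDist H O O') {η : ℝ}
    (hη : ((g : ℝ) + 1) ^ 2 * Real.sinh η ^ 2 ≤ spectralGap (hamiltonian H)) :
    connectedCorrelation ψ O O' ≤ (Real.cosh (m * (2 * η)))⁻¹ := by
  have hne : ((‖ψ‖⁻¹ : ℝ) : ℂ) ≠ 0 := Complex.ofReal_ne_zero.2 (inv_ne_zero (norm_ne_zero_iff.2 hψ))
  have hnorm : ‖((‖ψ‖⁻¹ : ℝ) : ℂ) • ψ‖ = 1 := by
    rw [norm_smul, Complex.norm_real, norm_inv, norm_norm,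
      inv_mul_cancel₀ (norm_ne_zero_iff.2 hψ)]
  have hspan := hker.trans (Submodule.span_singleton_smul_eq hne.isUnit ψ).symm
  have hmul : toOp (O * O') = toOp O * toOp O' := map_mul _ O O'
  have hstar : toOp Oᴴ = star (toOp O) := map_star _ O
  rw [connectedCorrelation, hmul, hstar]
  exact div_le_of_le_mul₀ (by positivity) (inv_pos.2 (Real.cosh_pos _)).le
    (norm_correlation_toOp_le hH hnorm hspan hg hfar hη)

theorem natCast_lt_of_ofReal_le {k : ℕ} {x : ℝ} {d : ℕ∞} (hk : (k : ℝ) < x)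
    (hx : ENNReal.ofReal x ≤ (d : ENNReal)) : (k : ℕ∞) < d := by
  rw [← ENat.toENNReal_lt, ENat.toENNReal_coe]
  exact (ENNReal.natCast_lt_ofReal.2 hk).trans_le hx

end Correlation

/-! ### Asymptotics -/

theorem inv_cosh_le_two_mul_exp_neg (x : ℝ) : (Real.cosh x)⁻¹ ≤ 2 * Real.exp (-x) := by
  rw [Real.exp_neg, ← div_eq_mul_inv, inv_le_comm₀ (Real.cosh_pos x) (by positivity), inv_div,
    Real.cosh_eq]
  linarith [Real.exp_pos (-x)]

theorem le_log_of_mul_rpow_le_inv_cosh {B L α x : ℝ} (hB : 0 < B) (hL : 0 < L)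
    (h : B * L ^ (-α) ≤ (Real.cosh x)⁻¹) : x ≤ α * Real.log L + Real.log (2 / B) := by
  have hlog := Real.log_le_log (by positivity) (h.trans (inv_cosh_le_two_mul_exp_neg x))
  rw [Real.log_mul hB.ne' (by positivity), Real.log_rpow hL,
    Real.log_mul two_ne_zero (Real.exp_pos _).ne', Real.log_exp] at hlog
  rw [Real.log_div two_ne_zero hB.ne']
  linarith

theorem sinh_le_two_mul {x : ℝ} (hx0 : 0 ≤ x) (hx1 : x ≤ 1) : Real.sinh x ≤ 2 * x := by
  have hexp := (abs_le.1 (Real.abs_exp_sub_one_sub_id_le (by rwa [abs_of_nonneg hx0]))).2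
  have hexp_neg := Real.add_one_le_exp (-x)
  rw [Real.sinh_eq]
  nlinarith

/-- The bound on the correlations is used with `m ≈ A L / (4 G)` and `η ≈ √γ / (2 G)`. -/
theorem le_mul_log_sq_div_sq {γ L A B α G : ℝ} (hγ : 0 ≤ γ) (hL : 0 < L) (hA : 0 < A)
    (hB : 0 < B) (hG : 0 < G) (hLA : 1 ≤ A * L / (4 * G))
    (hLB : Real.log (2 / B) ≤ Real.log L)
    (hLlog : 4 * G * (α + 1) / A * (Real.log L / L) < 1)
    (h : ∀ m : ℕ, 2 * G * m < A * L → ∀ η, G ^ 2 * Real.sinh η ^ 2 ≤ γ →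
      B * L ^ (-α) ≤ (Real.cosh (m * (2 * η)))⁻¹) :
    γ ≤ (8 * G ^ 2 * (α + 1) / A) ^ 2 * Real.log L ^ 2 / L ^ 2 := by
  set m := ⌊A * L / (4 * G)⌋₊
  set η := min 1 (√γ / (2 * G))
  have hη0 : 0 ≤ η := by positivity
  have hm_le : (m : ℝ) ≤ A * L / (4 * G) := Nat.floor_le (by positivity)
  have hm_ge : A * L / (4 * G) / 2 ≤ m := (Nat.div_two_lt_floor hLA).le
  have hm : 2 * G * m < A * L := by
    calc 2 * G * m ≤ 2 * G * (A * L / (4 * G)) := by gcongr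
      _ = A * L / 2 := by field_simp; norm_num
      _ < A * L := half_lt_self (by positivity)
  have hη : G ^ 2 * Real.sinh η ^ 2 ≤ γ := by
    calc G ^ 2 * Real.sinh η ^ 2 ≤ G ^ 2 * (2 * (√γ / (2 * G))) ^ 2 := by
          have := Real.sinh_nonneg_iff.2 hη0
          gcongr
          exact (sinh_le_two_mul hη0 (min_le_left _ _)).trans (by gcongr; exact min_le_right _ _)
      _ = √γ ^ 2 := by field_simp
      _ = γ := Real.sq_sqrt hγ
  have hmη : A * L / (4 * G) * η ≤ (α + 1) * Real.log L := by
    calc A * L / (4 * G) * η = A * L / (4 * G) / 2 * (2 * η) := by ring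
      _ ≤ m * (2 * η) := by gcongr
      _ ≤ α * Real.log L + Real.log (2 / B) := le_log_of_mul_rpow_le_inv_cosh hB hL (h m hm η hη)
      _ ≤ (α + 1) * Real.log L := by linarith
  have hη_le : η ≤ 4 * G * (α + 1) / A * (Real.log L / L) := by
    calc η ≤ (α + 1) * Real.log L / (A * L / (4 * G)) := (le_div_iff₀' (by positivity)).2 hmη
      _ = 4 * G * (α + 1) / A * (Real.log L / L) := by field_simp
  have hsqrt : √γ ≤ 8 * G ^ 2 * (α + 1) / A * (Real.log L / L) := by
    calc √γ ≤ 4 * G * (α + 1) / A * (Real.log L / L) * (2 * G) :=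
          (div_le_iff₀ (by positivity)).1 ((min_le_iff.1 hη_le).resolve_left hLlog.not_ge)
      _ = 8 * G ^ 2 * (α + 1) / A * (Real.log L / L) := by ring
  calc γ = √γ ^ 2 := (Real.sq_sqrt hγ).symm
    _ ≤ (8 * G ^ 2 * (α + 1) / A * (Real.log L / L)) ^ 2 := by gcongr
    _ = _ := by ring

theorem exists_eventually_le_mul_log_sq_div_sq {X : Type*} {l : Filter X} {γ L : X → ℝ}
    {A B α G : ℝ} (hγ : ∀ n, 0 ≤ γ n) (hL : Tendsto L l atTop) (hA : 0 < A) (hB : 0 < B)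
    (hα : 0 ≤ α) (hG : 0 < G)
    (h : ∀ᶠ n in l, ∀ m : ℕ, 2 * G * m < A * L n → ∀ η, G ^ 2 * Real.sinh η ^ 2 ≤ γ n →
      B * L n ^ (-α) ≤ (Real.cosh (m * (2 * η)))⁻¹) :
    ∃ C > 0, ∀ᶠ n in l, γ n ≤ C * Real.log (L n) ^ 2 / L n ^ 2 := by
  have hratio : Tendsto (fun n => Real.log (L n) / L n) l (𝓝 0) :=
    Real.isLittleO_log_id_atTop.tendsto_div_nhds_zero.comp hL
  have hratio_mul := hratio.const_mul (4 * G * (α + 1) / A)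
  rw [mul_zero] at hratio_mul
  have hquot := (hL.const_mul_atTop hA).atTop_div_const (show 0 < 4 * G by positivity)
  refine ⟨(8 * G ^ 2 * (α + 1) / A) ^ 2, by positivity, ?_⟩
  filter_upwards [h, hL.eventually_gt_atTop 0,
    hquot.eventually_ge_atTop 1,
    (Real.tendsto_log_atTop.comp hL).eventually_ge_atTop (Real.log (2 / B)),
    hratio_mul.eventually_lt_const one_pos] with n hn hpos hLA hLB hLlog
  exact le_mul_log_sq_div_sq (hγ n) hpos hA hB hG hLA hLB hLlog hn

theorem HasDynamicalExponent.two_le {gap L : ℕ → ℝ} {C z : ℝ}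
    (hz : HasDynamicalExponent gap L z) (hC : 0 < C) (hL : Tendsto L atTop atTop)
    (hpos : ∀ᶠ n in atTop, 0 < gap n)
    (hle : ∀ᶠ n in atTop, gap n ≤ C * Real.log (L n) ^ 2 / L n ^ 2) : 2 ≤ z := by
  have hlog : Tendsto (fun n => Real.log (L n)) atTop atTop := Real.tendsto_log_atTop.comp hL
  have hloglog : Tendsto (fun n => Real.log (Real.log (L n)) / Real.log (L n)) atTop (𝓝 0) :=
    Real.isLittleO_log_id_atTop.tendsto_div_nhds_zero.comp hlog
  have hlim : Tendsto (fun n => 2 - Real.log C / Real.log (L n) -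
      2 * (Real.log (Real.log (L n)) / Real.log (L n))) atTop (𝓝 2) := by
    simpa only [mul_zero, sub_zero] using
      (tendsto_const_nhds.sub (tendsto_const_nhds.div_atTop hlog)).sub (hloglog.const_mul 2)
  refine le_of_tendsto_of_tendsto hlim hz ?_
  filter_upwards [hpos, hle, hL.eventually_gt_atTop 0, hlog.eventually_gt_atTop 0]
    with n hgap_pos hgap_le hLpos hlogpos
  have hgap_log := Real.log_le_log hgap_pos hgap_le
  rw [Real.log_div (by positivity) (by positivity), Real.log_mul hC.ne' (by positivity),
    Real.log_pow, Real.log_pow, Nat.cast_two] at hgap_log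
  calc _ = (2 * Real.log (L n) - Real.log C - 2 * Real.log (Real.log (L n))) /
        Real.log (L n) := by field_simp
    _ ≤ -Real.log (gap n) / Real.log (L n) := by gcongr; linarith

theorem mainTheorem6_general
    {V : ℕ → Type*} [∀ n, Fintype (V n)] [∀ n, DecidableEq (V n)]
    (G : ∀ n, SimpleGraph (V n)) [∀ n, DecidableRel (G n).Adj]
    (hG : ∀ n, (G n).Connected)
    (Λ : ∀ n, PEPS (G n))
    (P : ∀ n, Finpartition (Finset.univ : Finset (V n)))
    (hP : ∀ n, (Λ n).IsInjectiveCovering (P n))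
    {S : ℕ → Type*} [∀ n, Fintype (S n)]
    (R : ∀ n, S n → Finset (V n))
    (hR : ∀ n, PEPS.RangesCover (G n) (R n) (P n))
    (g : ℕ)
    (hg : ∀ n i, ((interactionGraph ((Λ n).term (R n))).neighborSet i).ncard ≤ g)
    (hL : Tendsto (fun n => linearSize ((Λ n).term (R n))) atTop atTop)
    (O O' : ∀ n, Matrix (Conf (Λ n).physDim) (Conf (Λ n).physDim) ℂ)
    (A B α : ℝ) (hA : 0 < A) (hB : 0 < B) (hα : 0 ≤ α)
    (hdist : ∀ᶠ n in atTop, ENNReal.ofReal (A * linearSize ((Λ n).term (R n))) ≤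
      (opDist ((Λ n).term (R n)) (O n) (O' n) : ENNReal))
    (hcorr : ∀ᶠ n in atTop, B * (linearSize ((Λ n).term (R n)) : ℝ) ^ (-α) ≤
      connectedCorrelation (Λ n).state (O n) (O' n)) :
    (∀ n, (Λ n).state ≠ 0 ∧
      LinearMap.ker (toOp (hamiltonian ((Λ n).term (R n)))).toLinearMap =
        Submodule.span ℂ {(Λ n).state}) ∧
    (∃ C : ℝ, ∀ᶠ n in atTop, spectralGap (hamiltonian ((Λ n).term (R n))) ≤
      C * Real.log (linearSize ((Λ n).term (R n))) ^ 2 /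
        (linearSize ((Λ n).term (R n)) : ℝ) ^ 2) ∧
    (∀ z : ℝ, HasDynamicalExponent
      (fun n => spectralGap (hamiltonian ((Λ n).term (R n))))
      (fun n => (linearSize ((Λ n).term (R n)) : ℝ)) z → 2 ≤ z) := by
  have hproj (n : ℕ) (i : S n) : IsStarProjection ((Λ n).term (R n) i) :=
    isStarProjection_parentTerm (Λ n).state (R n) i
  have hne (n : ℕ) : (Λ n).state ≠ 0 := PEPS.state_ne_zero (hP n).2
  have hker (n : ℕ) := PEPS.ker_hamiltonian_eq_span (hG n) (hP n) (hR n)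
  have hL' := tendsto_natCast_atTop_atTop (R := ℝ).comp hL
  obtain ⟨C, hC, hgap⟩ := exists_eventually_le_mul_log_sq_div_sq (G := g + 1)
    (fun n => spectralGap_nonneg (posSemidef_hamiltonian (hproj n))) hL' hA hB hα
    (by positivity) <| by
      filter_upwards [hdist, hcorr] with n hdist_n hcorr_n m hm η hη
      exact hcorr_n.trans <| connectedCorrelation_le (hproj n) (hne n) (hker n) (hg n)
        (natCast_lt_of_ofReal_le (by exact_mod_cast hm) hdist_n) hη
  refine ⟨fun n => ⟨hne n, hker n⟩, ⟨C, hgap⟩, fun z hz => hz.two_le hC hL' ?_ hgap⟩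
  filter_upwards [hL.eventually_gt_atTop 0] with n hn
  exact spectralGap_pos (posSemidef_hamiltonian (hproj n)) (hamiltonian_ne_zero (hproj n) hn.ne')

theorem mainTheorem6
    -- a sequence of injective PEPS on finite connected graphs
    {V : ℕ → Type*} [∀ n, Fintype (V n)] [∀ n, DecidableEq (V n)]
    (G : ∀ n, SimpleGraph (V n)) [∀ n, DecidableRel (G n).Adj]
    (hG : ∀ n, (G n).Connected)
    (Λ : ∀ n, PEPS (G n))
    (P : ∀ n, Finpartition (Finset.univ : Finset (V n)))
    (hP : ∀ n, (Λ n).IsInjectiveCovering (P n))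
    -- sufficiently large interaction ranges
    {S : ℕ → Type*} [∀ n, Fintype (S n)]
    (R : ∀ n, S n → Finset (V n))
    (hR : ∀ n, PEPS.RangesCover (G n) (R n) (P n))
    -- locality, connectedness of the interaction graphs, growing linear size
    (g : ℕ)
    (hg : ∀ n i, ((interactionGraph ((Λ n).term (R n))).neighborSet i).ncard ≤ g)
    (hconn : ∀ n, (interactionGraph ((Λ n).term (R n))).Connected)
    (hL : Tendsto (fun n => linearSize ((Λ n).term (R n))) atTop atTop)
    -- algebraic correlations of local operators in the ground state
    (O O' : ∀ n, Matrix (Conf (Λ n).physDim) (Conf (Λ n).physDim) ℂ)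
    (k : ℕ)
    (hO : ∀ n, ∃ X : Finset (V n), X.card ≤ k ∧ IsSupportedOn (O n) X)
    (hO' : ∀ n, ∃ X : Finset (V n), X.card ≤ k ∧ IsSupportedOn (O' n) X)
    (A B α : ℝ) (hA : 0 < A) (hB : 0 < B) (hα : 0 ≤ α)
    (hdist : ∀ᶠ n in atTop, ENNReal.ofReal (A * linearSize ((Λ n).term (R n))) ≤
      (opDist ((Λ n).term (R n)) (O n) (O' n) : ENNReal))
    (hcorr : ∀ᶠ n in atTop, B * (linearSize ((Λ n).term (R n)) : ℝ) ^ (-α) ≤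
      connectedCorrelation (Λ n).state (O n) (O' n)) :
    -- the PEPS is the unique ground state
    (∀ n, (Λ n).state ≠ 0 ∧
      LinearMap.ker (toOp (hamiltonian ((Λ n).term (R n)))).toLinearMap =
        Submodule.span ℂ {(Λ n).state}) ∧
    -- the gap closes at least as fast as `L⁻²`, up to logarithms
    (∃ C : ℝ, ∀ᶠ n in atTop, spectralGap (hamiltonian ((Λ n).term (R n))) ≤
      C * Real.log (linearSize ((Λ n).term (R n))) ^ 2 /
        (linearSize ((Λ n).term (R n)) : ℝ) ^ 2) ∧
    -- the dynamical exponent is at least two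
    (∀ z : ℝ, HasDynamicalExponent
      (fun n => spectralGap (hamiltonian ((Λ n).term (R n))))
      (fun n => (linearSize ((Λ n).term (R n)) : ℝ)) z → 2 ≤ z) := by
  exact mainTheorem6_general G hG Λ P hP R hR g hg hL O O' A B α hA hB hα hdist hcorr
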